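/- Let $N\ge 1$ be an integer, $w\in\mathbb C$ with $|w|=1$, $\epsilon\in\{0,1\}$ and $r>5$ (for example the level, Fricke constant, parity and spectral parameter of a cuspidal Maass newform $f$ of weight $0$ with Laplace eigenvalue $\frac14+r^2$). For $\theta\in(0,\pi/2)$ and $s\in\mathbb C$ with $\Re s>0$ put $$\gamma_\theta(s,f)=i^{-\epsilon}w^{-1/2}\Big(\frac{\cos\theta}{\sqrt N}\Big)^{1/2-s}\Gamma_{\mathbb R}(s+\epsilon+ir)\,\Gamma_{\mathbb R}(s+\epsilon-ir)\;{}_2F_1\Big(\frac{s+\epsilon+ir}2,\frac{s+\epsilon-ir}2;\frac12+\epsilon;-\tan^2\theta\Big),$$ where $\Gamma_{\mathbb R}(s)=\pi^{-s/2}\Gamma(s/2)$ and ${}_2F_1$ is the Gauss hypergeometric function, analytically continued from the unit disc to $\mathbb C\setminus[1,\infty)$. Let $0<\theta_1<\theta_2<\pi/2$ with $\cos\theta_2=e^{-\pi/(2r)}\cos\theta_1$. (1) If $s=\sigma+it$ with $\frac12\le\sigma\le1$, $t\in\mathbb R$, and $\cos\theta_1\le(4+|t^2-r^2|)^{-1/2}$,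 then $$\max\big(|\gamma_{\theta_1}(s,f)|,|\gamma_{\theta_2}(s,f)|\big)\ \ge\ \tfrac23(\cos\theta_2)^{\frac12+\epsilon}(2\pi)^{-\epsilon}\Big(\frac{\pi}{r\sinh(\pi r)}\Big)^{1/2}.$$ (2) If $\cos\theta_1\le(4+|t_0^2-r^2|)^{-1/2}$ for some $t_0\in\mathbb R$, then $\gamma_{\theta_1}(\cdot,f)$ and $\gamma_{\theta_2}(\cdot,f)$ have no common zero on the critical line: there is no $t\in\mathbb R$ with $\gamma_{\theta_1}(\frac12+it,f)=\gamma_{\theta_2}(\frac12+it,f)=0$. -/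

import Mathlib

open scoped Topology

/-- `w` is the value at `z` of the analytic continuation, along the straight segment from `0` to
`z`, of the Gauss hypergeometric series with parameters `a`, `b`, `c`. Since
`ℂ ∖ [1, ∞)` is star-shaped about `0`, for `z` in that set this is the value of the principal
branch. -/
def IsHyp2F1Value (a b c z w : ℂ) : Prop :=
  ∃ F : ℂ → ℂ, AnalyticOnNhd ℂ F (segment ℝ 0 z) ∧ F =ᶠ[𝓝 0] ₂F₁ a b c ∧ F z = w

theorem IsHyp2F1Value.unique {a b c z w w' : ℂ} (h : IsHyp2F1Value a b c z w)
    (h' : IsHyp2F1Value a b c z w') : w = w' := by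
  obtain ⟨F, hF, hF0, rfl⟩ := h
  obtain ⟨G, hG, hG0, rfl⟩ := h'
  exact hF.eqOn_of_preconnected_of_eventuallyEq hG (convex_segment (𝕜 := ℝ) 0 z).isPreconnected
    (left_mem_segment ℝ 0 z) (hF0.trans hG0.symm) (right_mem_segment ℝ 0 z)

/-- The (principal branch of the) Gauss hypergeometric function `₂F₁(a, b; c; z)`, as the analytic
continuation of the hypergeometric series from `0`. -/
noncomputable def hyp2F1 (a b c z : ℂ) : ℂ :=
  Classical.epsilon (IsHyp2F1Value a b c z)

theorem IsHyp2F1Value.hyp2F1_eq {a b c z w : ℂ} (h : IsHyp2F1Value a b c z w) :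
    hyp2F1 a b c z = w :=
  (Classical.epsilon_spec (p := IsHyp2F1Value a b c z) ⟨w, h⟩).unique h

/-- The twisted `Γ`-factor `γ_θ(s, f)` of a weight-`0` Maass newform `f`, which depends on `f` only
through its level `N`, its Fricke constant `w` (of modulus `1`), its parity `ε ∈ {0, 1}` and its
spectral parameter `r` (Laplace eigenvalue `1/4 + r²`). -/
noncomputable def twistedGamma (N : ℕ) (w : ℂ) (ε : ℕ) (r θ : ℝ) (s : ℂ) : ℂ :=
  Complex.I ^ (-(ε : ℤ)) * w ^ (-(1 / 2) : ℂ)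
    * ((Real.cos θ / Real.sqrt N : ℝ) : ℂ) ^ ((1 / 2 : ℂ) - s)
    * Complex.Gammaℝ (s + ε + Complex.I * r) * Complex.Gammaℝ (s + ε - Complex.I * r)
    * hyp2F1 ((s + ε + Complex.I * r) / 2) ((s + ε - Complex.I * r) / 2) (1 / 2 + ε)
        (-((Real.tan θ : ℝ) : ℂ) ^ 2)

/-- The set of real `t` such that `1/2 + it` is a zero of `γ_θ(·, f)`. -/
def criticalZeros (N : ℕ) (w : ℂ) (ε : ℕ) (r θ : ℝ) : Set ℝ :=
  {t : ℝ | twistedGamma N w ε r θ ((1 / 2 : ℂ) + Complex.I * t) = 0}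

/-!
With `a = (s + ε + ir) / 2`, `b = (s + ε - ir) / 2`, `c = 1/2 + ε` and `x = cos² θ`, Pfaff's
transformation turns the hypergeometric function of `γ_θ` into `(cos θ) ^ (2a)` times `F(1 - x)`,
where `F = ₂F₁(a, c - b; c; ·)`. All arguments now lie in the unit disc, and the exponents of `F` at
the singular point `1` differ by the imaginary number `ir`.

The connection formula (`hypergeometric_connection`) writes `F(1 - x) = α u(x) + β x ^ (-ir) v(x)`,
where `α`, `β` are quotients of Gamma values and `u`, `v` are power series with constant term `1`.
Its proof needs only Wronskians, which are constant after multiplication by a weight and can be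
evaluated at the singular point `1`: the one of `F` with the solution regular at `1` is read off
from `(1 - w) F'(w)` as `w → 1`, hence by an Abelian theorem from the coefficients of `F'`, which
the Euler limit for `Γ` shows to be asymptotic to `Γ(C) / (Γ(A) Γ(B)) n ^ (A + B - C)`. The other
coefficient follows from Euler's transformation.

For the lower bound, the hypothesis on `cos θ₁` makes the ratios of consecutive terms of the series
`u` and `v` at most `1/4`, and the first one at most `1/8`, so that `|u - 1|, |v - 1| ≤ 1/6`
(`norm_hypergeometric_sub_one_le`). Since `x₂ = e ^ (-π/r) x₁`, the factor `x ^ (-ir)` changes sign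
between the two angles, and the parallelogram law shows that the larger of the two values of `|F|`
is at least `(1 - √2/6) √(|α|² + |β|²)` (`le_max_norm_add_norm_sub`). After multiplication by the
archimedean factors `|α|` and `|β|` are `|Γ(ir)|` times powers of `2` and `π` and the quotients
`|Γ((σ + ε + iy)/2) / Γ((1 - σ + ε + iy)/2)|`, where `y = t ± r`. One of the two `|y|` exceeds `5`,
and there a comparison of Euler products bounds the quotient from below (`rpow_mul_norm_Gamma_le`).

On the critical line, `w ^ (c/2) (1 - w) ^ ((1 + ir)/2) F(w)` solves `q'' = -Q q` with a real
potential `Q`, which for `x ≤ 1/4` is less than that of the elementary function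
`√x cos (ρ (log x - m))`, `ρ = 7r/10`. Sturm comparison excludes zeros at two points at which the
values of `log x` are `π/r` apart; the size of `t` is immaterial, because `t²` only decreases `Q`.
-/

open Filter Set

/-! ### Power series with radius of convergence at least one -/

theorem hasSum_deriv_and_differentiableAt_tsum_mul_pow {c : ℕ → ℂ} (hc : ∀ ρ : ℝ, 0 ≤ ρ → ρ < 1 →
    Summable fun n => ‖c n‖ * ρ ^ n)
    {z : ℂ} (hz : ‖z‖ < 1) :
    HasSum (fun n : ℕ => ((n : ℂ) + 1) * c (n + 1) * z ^ n) (deriv (fun z => ∑' n, c n * z ^ n) z) ∧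
    DifferentiableAt ℂ (fun z => ∑' n, c n * z ^ n) z := by
  obtain ⟨ρ, hzρ, hρ⟩ := exists_between hz
  have hρ0 : 0 ≤ ρ := (norm_nonneg z).trans hzρ.le
  have hd : ∀ n : ℕ, DifferentiableOn ℂ (fun z : ℂ => c n * z ^ n) (Metric.ball 0 ρ) :=
      fun n => by fun_prop
  have hb : ∀ (n : ℕ) (w : ℂ), w ∈ Metric.ball (0 : ℂ) ρ → ‖c n * w ^ n‖ ≤ ‖c n‖ * ρ ^ n := by
    intro n w hw
    rw [norm_mul, norm_pow]
    have : ‖w‖ ≤ ρ := by simpa using (mem_ball_zero_iff.1 hw).le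
    gcongr
  have hzm : z ∈ Metric.ball (0 : ℂ) ρ := by simpa using hzρ
  constructor
  · have h := Complex.hasSum_deriv_of_summable_norm (hc ρ hρ0 hρ) hd Metric.isOpen_ball hb hzm
    rw [← hasSum_nat_add_iff' 1] at h
    simp only [Finset.range_one, Finset.sum_singleton, pow_zero, mul_one, deriv_const,
        sub_zero] at h
    refine h.congr_fun fun n => ?_
    rw [deriv_const_mul _ (by fun_prop)]
    simp
    ring
  · exact (Complex.differentiableOn_tsum_of_summable_norm (hc ρ hρ0 hρ) hd Metric.isOpen_ball
      hb).differentiableAt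
      (Metric.isOpen_ball.mem_nhds hzm)

theorem summable_norm_deriv_coeff {c : ℕ → ℂ} (hc : ∀ ρ : ℝ, 0 ≤ ρ → ρ < 1 →
    Summable fun n => ‖c n‖ * ρ ^ n)
    (ρ : ℝ) (hρ0 : 0 ≤ ρ) (hρ : ρ < 1) : Summable fun n : ℕ => ‖((n : ℂ) + 1) * c (n + 1)‖
        * ρ ^ n := by
  have hz : ‖(ρ : ℂ)‖ < 1 := by simpa [abs_of_nonneg hρ0] using hρ
  have := (hasSum_deriv_and_differentiableAt_tsum_mul_pow hc hz).1.summable.norm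
  simpa [abs_of_nonneg hρ0] using this

/-! ### The hypergeometric differential equation -/

/-- The `n`-th Taylor coefficient of `₂F₁ A B C` at the origin. -/
noncomputable def hgCoeff (A B C : ℂ) (n : ℕ) : ℂ := ordinaryHypergeometricCoefficient A B C n

theorem hgCoeff_zero (A B C : ℂ) : hgCoeff A B C 0 = 1 := by
  simp [hgCoeff, ordinaryHypergeometricCoefficient]

theorem hgCoeff_succ {A B C : ℂ} (n : ℕ) :
    hgCoeff A B C (n + 1) = hgCoeff A B C n * ((A + n) * (B + n) / ((C + n) * (n + 1))) := by
  simp only [hgCoeff, ordinaryHypergeometricCoefficient, ascPochhammer_succ_eval,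
      Nat.factorial_succ]
  push_cast
  rw [mul_inv, mul_inv, div_eq_mul_inv, mul_inv]
  ring

theorem ordinaryHypergeometric_eq_tsum_hgCoeff (A B C : ℂ) :
    (₂F₁ A B C : ℂ → ℂ) = fun z => ∑' n, hgCoeff A B C n * z ^ n := by
  rw [ordinaryHypergeometric_eq_tsum]
  rfl

theorem summable_norm_hgCoeff (A B C : ℂ) (ρ : ℝ) (hρ0 : 0 ≤ ρ) (hρ : ρ < 1) :
    Summable fun n => ‖hgCoeff A B C n‖ * ρ ^ n := by
  obtain ⟨ρ', h1, h2⟩ := exists_between hρ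
  refine summable_of_ratio_norm_eventually_le h2 ?_
  have key : Tendsto (fun n : ℕ => (A + n) * (B + n) / ((C + n) * (n + 1)) : ℕ
      → ℂ) atTop (𝓝 1) := by
    have h : ∀ E F : ℂ, Tendsto (fun n : ℕ => (E + n) / (F + n)) atTop (𝓝 1) := by
      intro E F
      have := tendsto_add_mul_div_add_mul_atTop_nhds E F (1 : ℂ) one_ne_zero
      simpa using this
    have := (h A C).mul (h B 1)
    simp only [mul_one] at this
    refine this.congr fun n => ?_
    rw [div_mul_div_comm, add_comm (1 : ℂ)]
  have k2 := (key.norm.mul_const ρ)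
  rw [norm_one, one_mul] at k2
  filter_upwards [k2.eventually_lt_const h1] with n hn
  rw [hgCoeff_succ]
  simp only [norm_mul, norm_pow, Real.norm_eq_abs, abs_norm, abs_of_nonneg hρ0] at hn ⊢
  rw [pow_succ]
  calc _ = (‖(A + n) * (B + n) / ((C + n) * (n + 1))‖ * ρ) * (‖hgCoeff A B C n‖ * ρ ^ n) := by ring
    _ ≤ _ := by gcongr

theorem differentiableOn_hypergeometric (A B C : ℂ) :
    DifferentiableOn ℂ (₂F₁ A B C : ℂ → ℂ) (Metric.ball 0 1) := by
  rw [ordinaryHypergeometric_eq_tsum_hgCoeff]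
  intro z hz
  exact (hasSum_deriv_and_differentiableAt_tsum_mul_pow (summable_norm_hgCoeff A B C)
      (by simpa using hz)).2.differentiableWithinAt

theorem analyticOnNhd_hypergeometric (A B C : ℂ) :
    AnalyticOnNhd ℂ (₂F₁ A B C : ℂ → ℂ) (Metric.ball 0 1) :=
  (differentiableOn_hypergeometric A B C).analyticOnNhd Metric.isOpen_ball

theorem hasDerivAt_hypergeometric (A B C : ℂ) {z : ℂ} (hz : ‖z‖ < 1) :
    HasDerivAt (₂F₁ A B C : ℂ → ℂ) (deriv (₂F₁ A B C) z) z :=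
  ((analyticOnNhd_hypergeometric A B C) z (by simpa using hz)).differentiableAt.hasDerivAt

theorem hasDerivAt_deriv_hypergeometric (A B C : ℂ) {z : ℂ} (hz : ‖z‖ < 1) :
    HasDerivAt (deriv (₂F₁ A B C : ℂ → ℂ)) (deriv (deriv (₂F₁ A B C)) z) z :=
  ((analyticOnNhd_hypergeometric A B C).deriv z (by simpa using hz)).differentiableAt.hasDerivAt

theorem hasSum_hypergeometric (A B C : ℂ) {z : ℂ} (hz : ‖z‖ < 1) :
    HasSum (fun n => hgCoeff A B C n * z ^ n) (₂F₁ A B C z) := by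
  rw [ordinaryHypergeometric_eq_tsum_hgCoeff]
  have := summable_norm_hgCoeff A B C ‖z‖ (norm_nonneg z) hz
  exact (Summable.of_norm (by simpa using this)).hasSum

theorem hasSum_deriv_hypergeometric (A B C : ℂ) {z : ℂ} (hz : ‖z‖ < 1) :
    HasSum (fun n : ℕ => ((n : ℂ) + 1) * hgCoeff A B C (n + 1) * z ^ n) (deriv (₂F₁ A B C) z) := by
  rw [ordinaryHypergeometric_eq_tsum_hgCoeff]
  exact (hasSum_deriv_and_differentiableAt_tsum_mul_pow (summable_norm_hgCoeff A B C) hz).1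

theorem hasSum_deriv_deriv_hypergeometric (A B C : ℂ) {z : ℂ} (hz : ‖z‖ < 1) :
    HasSum (fun n : ℕ => ((n : ℂ) + 1) * ((n + 2) * hgCoeff A B C (n + 2)) * z ^ n)
      (deriv (deriv (₂F₁ A B C)) z) := by
  have h := (hasSum_deriv_and_differentiableAt_tsum_mul_pow (summable_norm_deriv_coeff
      (summable_norm_hgCoeff A B C)) hz).1
  have e : deriv (₂F₁ A B C : ℂ → ℂ) =ᶠ[𝓝 z]
      fun z => ∑' n : ℕ, (((n : ℂ) + 1) * hgCoeff A B C (n + 1)) * z ^ n := by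
    filter_upwards [Metric.isOpen_ball.mem_nhds (show z ∈ Metric.ball (0 : ℂ) 1 by simpa using hz)]
        with u hu
    exact (hasSum_deriv_hypergeometric A B C (by simpa using hu)).tsum_eq.symm
  rw [e.deriv_eq]
  convert h using 3 with n
  push_cast
  ring_nf

/-- The Gauss hypergeometric equation with parameters `A`, `B`, `C` at the point `z`, for the values
`y`, `y₁`, `y₂` of a function and of its first two derivatives. -/
def HypEq (A B C z y y₁ y₂ : ℂ) : Prop :=
  z * (1 - z) * y₂ + (C - (A + B + 1) * z) * y₁ - A * B * y = 0

theorem hypEq_hypergeometric {A B C : ℂ} (hC : ∀ n : ℕ, C + n ≠ 0) {z : ℂ} (hz : ‖z‖ < 1) :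
    HypEq A B C z (₂F₁ A B C z) (deriv (₂F₁ A B C) z) (deriv (deriv (₂F₁ A B C)) z) := by
  have h0 := hasSum_hypergeometric A B C hz
  have h1 := hasSum_deriv_hypergeometric A B C hz
  have h2 := hasSum_deriv_deriv_hypergeometric A B C hz
  -- the series of `z F'`, `z F''`, `z² F''`, all with general term a multiple of `z ^ n`
  have k1 : HasSum (fun n : ℕ => (n : ℂ) * hgCoeff A B C n * z ^ n) (z * deriv (₂F₁ A B C) z) := by
    rw [← hasSum_nat_add_iff' 1]
    simp only [Finset.range_one, Finset.sum_singleton, Nat.cast_zero, zero_mul, sub_zero]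
    refine (h1.mul_left z).congr_fun fun n => ?_
    push_cast; ring
  have k2 : HasSum (fun n : ℕ => (n : ℂ) * (n + 1) * hgCoeff A B C (n + 1) * z ^ n)
      (z * deriv (deriv (₂F₁ A B C)) z) := by
    rw [← hasSum_nat_add_iff' 1]
    simp only [Finset.range_one, Finset.sum_singleton, Nat.cast_zero, zero_mul, sub_zero]
    refine (h2.mul_left z).congr_fun fun n => ?_
    push_cast; ring
  have k3 : HasSum (fun n : ℕ => (n : ℂ) * (n - 1) * hgCoeff A B C n * z ^ n)
      (z * (z * deriv (deriv (₂F₁ A B C)) z)) := by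
    rw [← hasSum_nat_add_iff' 1]
    simp only [Finset.range_one, Finset.sum_singleton, Nat.cast_zero, zero_mul, sub_zero]
    refine (k2.mul_left z).congr_fun fun n => ?_
    push_cast; ring
  have tot := (((k2.sub k3).add (h1.mul_left C)).sub (k1.mul_left (A + B
      + 1))).sub (h0.mul_left (A * B))
  have hz0 : ∀ n : ℕ, (n : ℂ) * (n + 1) * hgCoeff A B C (n + 1) * z ^ n
      - (n : ℂ) * (n - 1) * hgCoeff A B C n * z ^ n
      + C * (((n : ℂ) + 1) * hgCoeff A B C (n + 1) * z ^ n)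
      - (A + B + 1) * ((n : ℂ) * hgCoeff A B C n * z ^ n) - A * B * (hgCoeff A B C n * z ^ n)
          = 0 := by
    intro n
    have hn : (n : ℂ) + 1 ≠ 0 := by exact_mod_cast n.succ_ne_zero
    have := hC n
    rw [hgCoeff_succ]
    field_simp
    ring
  simp only [hz0] at tot
  have := tot.unique hasSum_zero
  unfold HypEq
  linear_combination this

/-! ### Pfaff's transformation -/

/-- At the regular singular point `0` the hypergeometric equation has exponents `0` and `1 - C`, so
an analytic solution which vanishes at `0` vanishes identically. -/
theorem HypEq.eventually_eq_zero {A B C : ℂ} (hC : ∀ n : ℕ, C + n ≠ 0) {D : ℂ → ℂ}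
    (hD : AnalyticAt ℂ D 0) (h0 : D 0 = 0)
    (heq : ∀ᶠ z in 𝓝 0, HypEq A B C z (D z) (deriv D z) (deriv (deriv D) z)) :
    ∀ᶠ z in 𝓝 0, D z = 0 := by
  by_contra hne
  obtain ⟨n, g, hg, hg0, hDg⟩ := hD.exists_eventuallyEq_pow_smul_nonzero_iff.2 hne
  simp only [sub_zero, smul_eq_mul] at hDg
  obtain _ | m := n
  · exact hg0 (by simpa [h0] using hDg.self_of_nhds.symm)
  set h : ℂ → ℂ := fun z => (m + 1) * g z + z * deriv g z with hh
  have hha : AnalyticAt ℂ h 0 := by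
    have := hg.deriv
    fun_prop
  have e1 : deriv D =ᶠ[𝓝 0] fun z => z ^ m * h z := by
    filter_upwards [EventuallyEq.eventuallyEq_nhds hDg, hg.eventually_analyticAt] with z hz hgz
    rw [EventuallyEq.deriv_eq hz]
    have : deriv (fun x => x ^ (m + 1) * g x) z = _ :=
      ((hasDerivAt_pow (m + 1) z).mul hgz.differentiableAt.hasDerivAt).deriv
    rw [this, hh]
    push_cast
    ring
  have e2 : ∀ᶠ z in 𝓝 0, z * deriv (deriv D) z = z ^ m * (m * h z + z * deriv h z) := by
    filter_upwards [e1.eventuallyEq_nhds, hha.eventually_analyticAt] with z hz hgz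
    rw [hz.deriv_eq]
    have : deriv (fun x => x ^ m * h x) z = _ :=
      ((hasDerivAt_pow m z).mul hgz.differentiableAt.hasDerivAt).deriv
    rw [this]
    obtain _ | k := m
    · simp
    · push_cast
      ring
  set L : ℂ → ℂ := fun z => (1 - z) * (m * h z + z * deriv h z) + (C - (A + B + 1) * z) * h z
    - A * B * (z * g z) with hL
  have hLc : ContinuousAt L 0 := by
    have h1 := hha.deriv.continuousAt
    have h2 := hha.continuousAt
    have h3 := hg.continuousAt
    fun_prop
  have hL0 : ∀ᶠ z in 𝓝[≠] 0, L z = 0 := by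
    filter_upwards [self_mem_nhdsWithin, heq.filter_mono nhdsWithin_le_nhds,
      e1.filter_mono nhdsWithin_le_nhds, e2.filter_mono nhdsWithin_le_nhds,
      hDg.filter_mono nhdsWithin_le_nhds] with z hz0 hz h1 h2 h3
    have : z ^ m ≠ 0 := pow_ne_zero _ hz0
    refine (mul_eq_zero.1 ?_).resolve_left this
    unfold HypEq at hz
    rw [h1, h3] at hz
    rw [hL]
    linear_combination hz - (1 - z) * h2
  have hlim : L 0 = 0 :=
    tendsto_nhds_unique (hLc.tendsto.mono_left nhdsWithin_le_nhds)
      (tendsto_const_nhds.congr' (hL0.mono fun z hz => hz.symm))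
  have : (m + C) * ((m + 1) * g 0) = 0 := by
    simp only [hL, hh] at hlim
    linear_combination hlim
  rcases mul_eq_zero.1 this with h1 | h1
  · exact hC m (by rw [add_comm]; exact h1)
  · exact (mul_ne_zero (by exact_mod_cast m.succ_ne_zero) hg0) h1

theorem one_sub_mem_slitPlane_of_re_lt {z : ℂ} (hz : z.re < 1) : 1 - z ∈ Complex.slitPlane := by
  left; simpa using hz

theorem norm_div_sub_one_lt_one {z : ℂ} (hz : z.re < 1 / 2) : ‖z / (z - 1)‖ < 1 := by
  have h1 : z - 1 ≠ 0 := fun h => by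
    have := congrArg Complex.re h
    simp at this; linarith
  rw [norm_div, div_lt_one (norm_pos_iff.2 h1)]
  refine lt_of_pow_lt_pow_left₀ 2 (norm_nonneg _) ?_
  rw [← Complex.normSq_eq_norm_sq, ← Complex.normSq_eq_norm_sq, Complex.normSq_apply,
      Complex.normSq_apply]
  simp
  nlinarith

theorem hasDerivAt_cpow_mul_comp_div_sub_one {e z p : ℂ} {Ψ : ℂ → ℂ} (hz : z.re < 1)
    (hΨ : HasDerivAt Ψ p (z / (z - 1))) :
    HasDerivAt (fun z => (1 - z) ^ e * Ψ (z / (z - 1)))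
      (-e * (1 - z) ^ (e - 1) * Ψ (z / (z - 1)) - (1 - z) ^ (e - 2) * p) z := by
  have hs := one_sub_mem_slitPlane_of_re_lt hz
  have h0 : (1 - z) ≠ 0 := Complex.slitPlane_ne_zero hs
  have h1 : z - 1 ≠ 0 := fun h => h0 (by linear_combination -h)
  have k1 := ((hasDerivAt_id z).const_sub 1).cpow_const (c := e) (by simpa using hs)
  have k2 := (hasDerivAt_id z).div ((hasDerivAt_id z).sub_const 1) (by simpa using h1)
  have := k1.mul (hΨ.comp z k2)
  refine this.congr_deriv ?_
  simp only [id, Function.comp, Pi.div_apply]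
  have e2 : (1 - z) ^ (e - 2) = (1 - z) ^ e / (1 - z) ^ 2 := by
    rw [Complex.cpow_sub _ _ h0]; norm_cast
  rw [e2]
  field_simp
  ring

theorem pfaff_transformation_hypEq {a b c : ℂ} (hc : ∀ n : ℕ, c + n ≠ 0) {z : ℂ}
    (hz : z.re < 1 / 2) :
    DifferentiableAt ℂ (fun z => (1 - z) ^ (-a) * ₂F₁ a (c - b) c (z / (z - 1))) z ∧
    HypEq a b c z ((1 - z) ^ (-a) * ₂F₁ a (c - b) c (z / (z - 1)))
      (deriv (fun z => (1 - z) ^ (-a) * ₂F₁ a (c - b) c (z / (z - 1))) z)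
      (deriv (deriv (fun z => (1 - z) ^ (-a) * ₂F₁ a (c - b) c (z / (z - 1)))) z) := by
  set Φ : ℂ → ℂ := ₂F₁ a (c - b) c with hΦ
  have hd : ∀ {z : ℂ}, z.re < 1 / 2 → HasDerivAt (fun z => (1 - z) ^ (-a) * Φ (z / (z - 1)))
      (a * ((1 - z) ^ (-a - 1) * Φ (z / (z - 1))) - (1 - z) ^ (-a - 2)
          * deriv Φ (z / (z - 1))) z := by
    intro z hz
    have := hasDerivAt_cpow_mul_comp_div_sub_one (e := -a) (by linarith)
      (hasDerivAt_hypergeometric a (c - b) c (norm_div_sub_one_lt_one hz))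
    refine this.congr_deriv ?_
    ring
  refine ⟨(hd hz).differentiableAt, ?_⟩
  have hev : ∀ᶠ u : ℂ in 𝓝 z, u.re < 1 / 2 :=
    Complex.continuous_re.continuousAt.eventually_lt continuousAt_const hz
  have e : deriv (fun z => (1 - z) ^ (-a) * Φ (z / (z - 1))) =ᶠ[𝓝 z] fun z =>
      a * ((1 - z) ^ (-a - 1) * Φ (z / (z - 1))) - (1 - z) ^ (-a - 2) * deriv Φ (z / (z - 1)) :=
    hev.mono fun u hu => (hd hu).deriv
  have hz1 : z.re < 1 := by linarith
  have hlt := norm_div_sub_one_lt_one hz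
  have h2 := ((hasDerivAt_cpow_mul_comp_div_sub_one (e := -a - 1) hz1
      (hasDerivAt_hypergeometric a (c - b) c hlt)).const_mul a).sub
    (hasDerivAt_cpow_mul_comp_div_sub_one (e := -a - 2) hz1
      (hasDerivAt_deriv_hypergeometric a (c - b) c hlt))
  rw [e.deriv_eq, (hd hz).deriv]
  have h2' := h2.deriv
  simp only [Pi.sub_def, ← hΦ] at h2'
  rw [h2']
  have ode := hypEq_hypergeometric (A := a) (B := c - b) hc hlt
  rw [← hΦ] at ode
  have hs := one_sub_mem_slitPlane_of_re_lt hz1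
  have h0 : (1 - z) ≠ 0 := Complex.slitPlane_ne_zero hs
  have h1 : z - 1 ≠ 0 := fun h => h0 (by linear_combination -h)
  have pw : ∀ k : ℕ, (1 - z) ^ (-a - k) = (1 - z) ^ (-a) / (1 - z) ^ k := fun k => by
    rw [Complex.cpow_sub _ _ h0, Complex.cpow_natCast]
  have p1 : (1 - z) ^ (-a - 1) = (1 - z) ^ (-a) / (1 - z) := by simpa using pw 1
  have p2 : (1 - z) ^ (-a - 2) = (1 - z) ^ (-a) / (1 - z) ^ 2 := by simpa using pw 2
  have p3 : (1 - z) ^ (-a - 1 - 1) = (1 - z) ^ (-a) / (1 - z) ^ 2 := by rw [← p2]; ring_nf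
  have p4 : (1 - z) ^ (-a - 1 - 2) = (1 - z) ^ (-a) / (1 - z) ^ 3 := by
    rw [← pw 3]; norm_num; ring_nf
  have p5 : (1 - z) ^ (-a - 2 - 1) = (1 - z) ^ (-a) / (1 - z) ^ 3 := by
    rw [← pw 3]; norm_num; ring_nf
  have p6 : (1 - z) ^ (-a - 2 - 2) = (1 - z) ^ (-a) / (1 - z) ^ 4 := by
    rw [← pw 4]; norm_num; ring_nf
  rw [p1, p2, p3, p4, p5, p6]
  unfold HypEq at ode ⊢
  generalize (1 - z) ^ (-a) = P
  generalize Φ (z / (z - 1)) = y at *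
  generalize deriv Φ (z / (z - 1)) = y1 at *
  generalize deriv (deriv Φ) (z / (z - 1)) = y2 at *
  obtain ⟨v, rfl⟩ : ∃ v, z = 1 - v := ⟨1 - z, by ring⟩
  have hv : v ≠ 0 := by simpa using h0
  have hu : (1 - v) / (1 - v - 1) = (v - 1) / v := by
    rw [div_eq_div_iff h1 hv]; ring
  rw [hu] at ode
  simp only [sub_sub_cancel]
  have ode' : ((v - 1) * y2 + v * ((c * v - (a + (c - b) + 1) * (v - 1)) * y1 - a * (c - b) * y
      * v)) = 0 := by
    field_simp at ode
    linear_combination ode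
  field_simp
  linear_combination (-P) * ode'

theorem ordinaryHypergeometric_comm (a b c z : ℂ) : ₂F₁ a b c z = ₂F₁ b a c z := by
  rw [ordinaryHypergeometric, ordinaryHypergeometricSeries_symm, ordinaryHypergeometric]

theorem pfaff_transformation_eventuallyEq {a b c : ℂ} (hc : ∀ n : ℕ, c + n ≠ 0) :
    (fun z : ℂ => (1 - z) ^ (-a) * ₂F₁ a (c - b) c (z / (z - 1))) =ᶠ[𝓝 0] (₂F₁ a b c : ℂ → ℂ) := by
  set H : ℂ → ℂ := fun z => (1 - z) ^ (-a) * ₂F₁ a (c - b) c (z / (z - 1)) with hH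
  have hU : {z : ℂ | z.re < 1 / 2} ∈ 𝓝 (0 : ℂ) :=
    (isOpen_lt Complex.continuous_re continuous_const).mem_nhds (by norm_num [Set.mem_ofPred_eq])
  have hHa : AnalyticAt ℂ H 0 := by
    refine DifferentiableOn.analyticAt (s := {z : ℂ | z.re < 1 / 2}) (fun z hz => ?_) hU
    exact (pfaff_transformation_hypEq hc hz).1.differentiableWithinAt
  have hFa : AnalyticAt ℂ (₂F₁ a b c : ℂ → ℂ) 0 := analyticOnNhd_hypergeometric a b c 0 (by simp)
  have key := HypEq.eventually_eq_zero (A := a) (B := b) hc (hHa.sub hFa) (by simp [hH]) ?_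
  · filter_upwards [key] with z hz
    exact sub_eq_zero.1 hz
  · have hb : Metric.ball (0 : ℂ) 1 ∈ 𝓝 (0 : ℂ) := Metric.ball_mem_nhds 0 one_pos
    have e1 : deriv (H - ₂F₁ a b c) =ᶠ[𝓝 0] deriv H - deriv (₂F₁ a b c) := by
      filter_upwards [hHa.eventually_analyticAt, hFa.eventually_analyticAt] with z h1 h2
      exact deriv_sub h1.differentiableAt h2.differentiableAt
    filter_upwards [hU, hb, e1, e1.eventuallyEq_nhds, hHa.deriv.eventually_analyticAt,
      hFa.deriv.eventually_analyticAt] with z hz1 hz2 h1 h2 h3 h4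
    have o1 := (pfaff_transformation_hypEq (a := a) (b := b) hc hz1).2
    have o2 := hypEq_hypergeometric (A := a) (B := b) hc (z := z) (by simpa using hz2)
    rw [h2.deriv_eq, h1, deriv_sub h3.differentiableAt h4.differentiableAt]
    unfold HypEq at *
    simp only [Pi.sub_apply, hH] at *
    linear_combination o1 - o2

/-- Pfaff's transformation for the principal branch, on the negative real axis. -/
theorem hyp2F1_neg_eq {a b c : ℂ} (hc : ∀ n : ℕ, c + n ≠ 0) {x : ℝ} (hx : 0 ≤ x) :
    hyp2F1 a b c (-(x : ℂ)) = ((1 + x : ℝ) : ℂ) ^ (-a)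
        * ₂F₁ a (c - b) c ((x / (1 + x) : ℝ) : ℂ) := by
  refine IsHyp2F1Value.hyp2F1_eq
    ⟨fun z => (1 - z) ^ (-a) * ₂F₁ a (c - b) c (z / (z - 1)), ?_,
        pfaff_transformation_eventuallyEq hc, ?_⟩
  · have hU : IsOpen {z : ℂ | z.re < 1 / 2} := isOpen_lt Complex.continuous_re continuous_const
    have : DifferentiableOn ℂ (fun z => (1 - z) ^ (-a) * ₂F₁ a (c - b) c (z / (z - 1)))
        {z : ℂ | z.re < 1 / 2} := fun z hz =>
      (pfaff_transformation_hypEq hc hz).1.differentiableWithinAt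
    refine (this.analyticOnNhd hU).mono ?_
    refine (convex_halfSpace_re_lt (1 / 2)).segment_subset ?_ ?_
    · norm_num [Set.mem_ofPred_eq]
    · simp [Set.mem_ofPred_eq]; linarith
  · have : (-(x : ℂ) / (-x - 1)) = ((x / (1 + x) : ℝ) : ℂ) := by
      push_cast
      rw [← neg_add', neg_div_neg_eq, add_comm]
    simp only [this]
    push_cast
    ring_nf

theorem analyticOnNhd_pfaff_transformation {a b c : ℂ} (hc : ∀ n : ℕ, c + n ≠ 0) :
    AnalyticOnNhd ℂ (fun z : ℂ => (1 - z) ^ (-a) * ₂F₁ a (c - b) c (z / (z - 1)))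
        {z : ℂ | z.re < 1 / 2} :=
  DifferentiableOn.analyticOnNhd
    (fun _ hz => (pfaff_transformation_hypEq hc hz).1.differentiableWithinAt)
    (isOpen_lt Complex.continuous_re continuous_const)

/-- Euler's transformation: it follows from Pfaff's by the symmetry of the hypergeometric function
in its first two parameters. -/
theorem euler_transformation {A B C : ℂ} (hC : ∀ n : ℕ, C + n ≠ 0) {w : ℂ} (hw : ‖w‖ < 1) :
    ₂F₁ A B C w = (1 - w) ^ (C - A - B) * ₂F₁ (C - A) (C - B) C w := by
  have hs : 1 - w ∈ Complex.slitPlane :=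
    one_sub_mem_slitPlane_of_re_lt ((Complex.re_le_norm w).trans_lt hw)
  have h0 : 1 - w ≠ 0 := Complex.slitPlane_ne_zero hs
  have h0' : w - 1 ≠ 0 := fun h => h0 (by linear_combination -h)
  have hE : EqOn (fun z : ℂ => (1 - z) ^ (-A) * ₂F₁ A (C - (C - B)) C (z / (z - 1)))
      (fun z : ℂ => (1 - z) ^ (-(C - B)) * ₂F₁ (C - B) (C - A) C (z / (z - 1)))
          {z : ℂ | z.re < 1 / 2} := by
    refine (analyticOnNhd_pfaff_transformation hC).eqOn_of_preconnected_of_eventuallyEq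
      (analyticOnNhd_pfaff_transformation hC) (convex_halfSpace_re_lt _).isPreconnected (z₀ := 0)
      (by norm_num [Set.mem_ofPred_eq]) ?_
    refine (pfaff_transformation_eventuallyEq hC).trans ?_
    refine EventuallyEq.trans ?_ (pfaff_transformation_eventuallyEq hC).symm
    exact Eventually.of_forall fun z => ordinaryHypergeometric_comm _ _ _ _
  have hz : (w / (w - 1)).re < 1 / 2 := by
    have : w / (w - 1) = 1 / 2 * (1 + (w + 1) / (w - 1)) := by field_simp; ring
    have e : ((w + 1) / (w - 1)).re = (Complex.normSq w - 1) / Complex.normSq (w - 1) := by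
      rw [Complex.div_re, ← add_div]
      congr 1
      simp [Complex.normSq_apply]
      ring
    have hn : Complex.normSq w < 1 := by
      rw [Complex.normSq_eq_norm_sq]
      nlinarith [norm_nonneg w]
    have : ((w + 1) / (w - 1)).re < 0 := by
      rw [e]
      exact div_neg_of_neg_of_pos (by linarith) (Complex.normSq_pos.2 h0')
    rw [‹w / (w - 1) = _›]
    norm_num
    linarith
  have h := hE hz
  have e1 : 1 - w / (w - 1) = (1 - w)⁻¹ := by
    rw [inv_eq_one_div, eq_div_iff h0]; field_simp; ring
  have e2 : w / (w - 1) / (w / (w - 1) - 1) = w := by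
    rw [show w / (w - 1) - 1 = 1 / (w - 1) by field_simp; ring]; field_simp
  have e3 : ∀ e : ℂ, ((1 - w)⁻¹) ^ (-e) = (1 - w) ^ e := by
    intro e
    rw [Complex.inv_cpow _ _ (Complex.slitPlane_arg_ne_pi hs), Complex.cpow_neg, inv_inv]
  simp only [e1, e2, e3, sub_sub_cancel] at h
  rw [ordinaryHypergeometric_comm (C - A), sub_right_comm, Complex.cpow_sub _ _ h0,
      div_mul_eq_mul_div, ← h]
  have : (1 - w) ^ A ≠ 0 := fun h => h0 ((Complex.cpow_eq_zero_iff _ _).1 h).1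
  field_simp

/-! ### Growth of the coefficients and an Abelian theorem -/

/-- Abelian theorem: a power series whose coefficients tend to `0` is `o(1 / (1 - w))` as `w → 1⁻`.
-/
theorem tendsto_one_sub_mul_tsum {d : ℕ → ℂ} (hd : Tendsto d atTop (𝓝 0)) :
    Tendsto (fun w : ℝ => ((1 : ℂ) - w) * ∑' n, d n * (w : ℂ) ^ n) (𝓝[<] 1) (𝓝 0) := by
  -- multiplication by `1 - w` replaces `d n` by the difference `d n - d (n - 1)`
  set f : ℕ → ℂ := fun n => d n - (if n = 0 then 0 else d (n - 1)) with hf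
  have hsum : ∀ n, ∑ i ∈ Finset.range (n + 1), f i = d n := by
    intro n
    induction n with
    | zero => simp [hf]
    | succ n ih => rw [Finset.sum_range_succ, ih]; simp [hf]
  have hlim : Tendsto (fun n => ∑ i ∈ Finset.range n, f i) atTop (𝓝 0) := by
    rw [← tendsto_add_atTop_iff_nat 1]
    simpa only [hsum] using hd
  have h := Complex.tendsto_tsum_powerSeries_nhdsWithin_lt hlim
  rw [tendsto_map'_iff] at h
  refine h.congr' ?_
  have hI : Ioo (0 : ℝ) 1 ∈ 𝓝[<] (1 : ℝ) := Ioo_mem_nhdsLT one_pos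
  filter_upwards [hI] with w hw
  obtain ⟨M, hM⟩ := hd.norm.bddAbove_range
  have hs : Summable fun n => d n * (w : ℂ) ^ n := by
    refine Summable.of_norm_bounded (g := fun n => M * w ^ n)
      ((summable_geometric_of_lt_one hw.1.le hw.2).mul_left M) fun n => ?_
    rw [norm_mul, norm_pow, Complex.norm_real, Real.norm_of_nonneg hw.1.le]
    have := pow_nonneg hw.1.le n
    gcongr
    exact hM ⟨n, rfl⟩
  have hs2 : HasSum (fun n => (if n = 0 then 0 else d (n - 1)) * (w : ℂ) ^ n)
      (w * ∑' n, d n * (w : ℂ) ^ n) := by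
    rw [← hasSum_nat_add_iff' 1]
    simp only [Finset.range_one, Finset.sum_singleton, if_true, zero_mul, sub_zero]
    refine (hs.hasSum.mul_left (w : ℂ)).congr_fun fun n => ?_
    simp only [Nat.add_sub_cancel, if_neg n.succ_ne_zero]
    ring
  have := (hs.hasSum.sub hs2).tsum_eq
  simp only [Function.comp, hf]
  rw [sub_mul, one_mul, ← this]
  congr 1
  funext n
  ring

theorem tendsto_inv_GammaSeq (s : ℂ) :
    Tendsto (fun n => (Complex.GammaSeq s n)⁻¹) atTop (𝓝 (Complex.Gamma s)⁻¹) := by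
  by_cases h : ∀ m : ℕ, s ≠ -m
  · exact (Complex.GammaSeq_tendsto_Gamma s).inv₀ (Complex.Gamma_ne_zero h)
  · push Not at h
    obtain ⟨m, rfl⟩ := h
    rw [Complex.Gamma_neg_nat_eq_zero]
    refine tendsto_const_nhds.congr' ?_
    filter_upwards [eventually_ge_atTop m] with n hn
    have : ∏ j ∈ Finset.range (n + 1), (-(m : ℂ) + j) = 0 :=
      Finset.prod_eq_zero (Finset.mem_range.2 (Nat.lt_succ_of_le hn)) (by simp)
    rw [Complex.GammaSeq, this, div_zero]

theorem ascPochhammer_eval_eq_GammaSeq (s : ℂ) {n : ℕ} (hn : n ≠ 0) :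
    (ascPochhammer ℂ (n + 1)).eval s = (n : ℂ) ^ s * n.factorial * (Complex.GammaSeq s n)⁻¹ := by
  have hn' : (n : ℂ) ^ s ≠ 0 := fun h => by simp [Complex.cpow_eq_zero_iff, hn] at h
  have hf : (n.factorial : ℂ) ≠ 0 := by exact_mod_cast n.factorial_ne_zero
  rw [Complex.GammaSeq, inv_div, mul_div_cancel₀ _ (mul_ne_zero hn' hf)]
  generalize n + 1 = m
  induction m with
  | zero => simp
  | succ m ih => rw [ascPochhammer_succ_eval, ih, Finset.prod_range_succ]

theorem deriv_coeff_eq_GammaSeq (A B C : ℂ) {n : ℕ} (hn : n ≠ 0) :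
    ((n : ℂ) + 1) * hgCoeff A B C (n + 1) = (n : ℂ) ^ (A + B - C) *
      ((Complex.GammaSeq A n)⁻¹ * (Complex.GammaSeq B n)⁻¹ * Complex.GammaSeq C n) := by
  have hn0 : (n : ℂ) ≠ 0 := by exact_mod_cast hn
  have hf : (n.factorial : ℂ) ≠ 0 := by exact_mod_cast n.factorial_ne_zero
  have h1 : (n : ℂ) + 1 ≠ 0 := by exact_mod_cast n.succ_ne_zero
  have hC : (n : ℂ) ^ C ≠ 0 := fun h => hn0 ((Complex.cpow_eq_zero_iff _ _).1 h).1
  simp only [hgCoeff, ordinaryHypergeometricCoefficient]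
  rw [ascPochhammer_eval_eq_GammaSeq A hn, ascPochhammer_eval_eq_GammaSeq B hn,
    ascPochhammer_eval_eq_GammaSeq C hn, Nat.factorial_succ, Complex.cpow_sub _ _ hn0,
    Complex.cpow_add _ _ hn0, mul_inv, mul_inv, inv_inv]
  push_cast
  field_simp

/-- The coefficients of the derivative of `₂F₁ A B C` are asymptotic to a multiple of
`n ^ (A + B - C)`. -/
theorem tendsto_deriv_coeff_div (A B C : ℂ) :
    Tendsto (fun n : ℕ => ((n : ℂ) + 1) * hgCoeff A B C (n + 1) / (n : ℂ) ^ (A + B - C)) atTop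
      (𝓝 (Complex.Gamma C / (Complex.Gamma A * Complex.Gamma B))) := by
  have h := ((tendsto_inv_GammaSeq A).mul (tendsto_inv_GammaSeq B)).mul
      (Complex.GammaSeq_tendsto_Gamma C)
  rw [div_eq_inv_mul, mul_inv]
  refine h.congr' ?_
  filter_upwards [eventually_ne_atTop 0] with n hn
  have hn0 : (n : ℂ) ≠ 0 := by exact_mod_cast hn
  rw [deriv_coeff_eq_GammaSeq A B C hn, mul_div_cancel_left₀ _
    (fun h => hn0 ((Complex.cpow_eq_zero_iff _ _).1 h).1)]

theorem norm_natCast_cpow_of_re_eq_zero {κ : ℂ} (hκ : κ.re = 0) {n : ℕ} (hn : n ≠ 0) :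
    ‖(n : ℂ) ^ κ‖ = 1 := by
  rw [Complex.norm_natCast_cpow_of_pos (Nat.pos_of_ne_zero hn), hκ, Real.rpow_zero]

theorem tendsto_hgCoeff_zero {A B C : ℂ} (hκ : (A + B - C).re = 0) :
    Tendsto (hgCoeff A B C) atTop (𝓝 0) := by
  rw [← tendsto_add_atTop_iff_nat 1, tendsto_zero_iff_norm_tendsto_zero]
  have h := (tendsto_deriv_coeff_div A B C).norm.mul tendsto_one_div_add_atTop_nhds_zero_nat
  rw [mul_zero] at h
  refine h.congr' ?_
  filter_upwards [eventually_ne_atTop 0] with n hn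
  have : ‖(n : ℂ) + 1‖ = n + 1 := by
    have := Complex.norm_natCast (n + 1)
    push_cast at this; exact this
  rw [norm_div, norm_natCast_cpow_of_re_eq_zero hκ hn, norm_mul, this]
  have : (n : ℝ) + 1 ≠ 0 := by positivity
  field_simp

theorem ordinaryHypergeometric_one_one {κ z : ℂ} (hz : ‖z‖ < 1) : ₂F₁ κ 1 1 z = (1 - z) ^ (-κ) := by
  have h1 : ∀ n : ℕ, (1 : ℂ) + n ≠ 0 := fun n => by
    rw [add_comm]; exact_mod_cast n.succ_ne_zero
  rw [euler_transformation h1 hz]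
  have : ₂F₁ (1 - κ) (1 - 1) 1 z = 1 := by
    refine (hasSum_hypergeometric _ _ _ hz).unique ?_
    have : ∀ n ≠ 0, hgCoeff (1 - κ) (1 - 1) 1 n * z ^ n = 0 := by
      intro n hn
      obtain ⟨m, rfl⟩ := Nat.exists_eq_succ_of_ne_zero hn
      simp [hgCoeff, ordinaryHypergeometricCoefficient, ascPochhammer_ne_zero_eval_zero]
    have h := hasSum_single 0 this
    simpa [hgCoeff_zero] using h
  rw [this, mul_one]
  congr 1
  ring

theorem deriv_ordinaryHypergeometric_one_one {κ z : ℂ} (hz : ‖z‖ < 1) :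
    deriv (₂F₁ κ 1 1) z = κ * (1 - z) ^ (-κ - 1) := by
  have he : (₂F₁ κ 1 1 : ℂ → ℂ) =ᶠ[𝓝 z] fun z => (1 - z) ^ (-κ) := by
    filter_upwards [Metric.isOpen_ball.mem_nhds (show z ∈ Metric.ball (0 : ℂ) 1 by simpa using hz)]
        with u hu
    exact ordinaryHypergeometric_one_one (by simpa using hu)
  have hs : 1 - z ∈ Complex.slitPlane :=
    one_sub_mem_slitPlane_of_re_lt ((Complex.re_le_norm z).trans_lt hz)
  rw [he.deriv_eq]
  have := (((hasDerivAt_id z).const_sub 1).cpow_const (c := -κ) (by simpa using hs)).deriv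
  simp only [id] at this
  rw [this]
  ring

theorem norm_ofReal_one_sub_cpow {κ : ℂ} (hκ : κ.re = 0) {w : ℝ} (hw : w < 1) :
    ‖((1 : ℂ) - w) ^ κ‖ = 1 := by
  rw [← Complex.ofReal_one, ← Complex.ofReal_sub, Complex.norm_cpow_eq_rpow_re_of_pos (by linarith),
      hκ,
    Real.rpow_zero]

theorem tendsto_cpow_mul_hypergeometric {A B C : ℂ} (hκ : (A + B - C).re = 0) :
    Tendsto (fun w : ℝ => ((1 : ℂ) - w) ^ (A + B - C + 1) * ₂F₁ A B C (w : ℂ)) (𝓝[<] 1) (𝓝 0) := by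
  have h := (tendsto_one_sub_mul_tsum (tendsto_hgCoeff_zero hκ)).norm
  rw [norm_zero] at h
  rw [tendsto_zero_iff_norm_tendsto_zero]
  refine h.congr' ?_
  filter_upwards [Ioo_mem_nhdsLT (zero_lt_one' ℝ)] with w hw
  have hx : (1 : ℂ) - w ≠ 0 := by
    rw [← Complex.ofReal_one, ← Complex.ofReal_sub]; exact_mod_cast (sub_pos.2 hw.2).ne'
  rw [ordinaryHypergeometric_eq_tsum_hgCoeff, Complex.cpow_add _ _ hx, Complex.cpow_one, norm_mul,
      norm_mul,
    norm_mul, norm_ofReal_one_sub_cpow hκ hw.2, one_mul]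

/-- The leading behaviour of the derivative of `₂F₁ A B C` at `1` when `A + B - C` is imaginary: its
coefficients are compared with those of `κ (1 - z) ^ (-κ - 1)`, `κ = A + B - C`. -/
theorem tendsto_cpow_mul_deriv_hypergeometric {A B C : ℂ} (hκ : (A + B - C).re = 0) (hκ0 : A
    + B - C ≠ 0) :
    Tendsto (fun w : ℝ => ((1 : ℂ) - w) ^ (A + B - C + 1) * deriv (₂F₁ A B C) (w : ℂ)) (𝓝[<] 1)
      (𝓝 (Complex.Gamma C * Complex.Gamma (A + B - C) / (Complex.Gamma A * Complex.Gamma B) * (A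
          + B - C))) := by
  set κ := A + B - C with hκd
  set K := Complex.Gamma C * Complex.Gamma κ / (Complex.Gamma A * Complex.Gamma B) with hK
  have hΓ : Complex.Gamma κ ≠ 0 := by
    refine Complex.Gamma_ne_zero fun m hm => ?_
    rw [hm] at hκ hκ0
    simp at hκ hκ0
    exact hκ0 hκ
  have hd : Tendsto (fun n : ℕ => ((n : ℂ) + 1) * hgCoeff A B C (n + 1)
      - K * (((n : ℂ) + 1) * hgCoeff κ 1 1 (n + 1))) atTop (𝓝 0) := by
    have h1 := tendsto_deriv_coeff_div A B C
    have h2 := tendsto_deriv_coeff_div κ 1 1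
    have h3 := (h1.sub (h2.const_mul K)).norm
    have e : Complex.Gamma C / (Complex.Gamma A * Complex.Gamma B)
        - K * (Complex.Gamma 1 / (Complex.Gamma κ * Complex.Gamma 1)) = 0 := by
      rw [hK, Complex.Gamma_one, mul_one]
      field_simp
      ring
    rw [e, norm_zero] at h3
    rw [tendsto_zero_iff_norm_tendsto_zero]
    refine h3.congr' ?_
    filter_upwards [eventually_ne_atTop 0] with n hn
    rw [add_sub_cancel_right, ← hκd, mul_div_assoc', ← sub_div, norm_div,
      norm_natCast_cpow_of_re_eq_zero hκ hn, div_one]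
  have h := (tendsto_one_sub_mul_tsum hd).norm
  rw [norm_zero] at h
  have h' : Tendsto (fun w : ℝ => ((1 : ℂ) - w) ^ (κ + 1) * deriv (₂F₁ A B C) (w : ℂ) - K * κ)
      (𝓝[<] 1)
      (𝓝 0) := by
    rw [tendsto_zero_iff_norm_tendsto_zero]
    refine h.congr' ?_
    filter_upwards [Ioo_mem_nhdsLT (zero_lt_one' ℝ)] with w hw
    have hx : (1 : ℂ) - w ≠ 0 := by
      rw [← Complex.ofReal_one, ← Complex.ofReal_sub]; exact_mod_cast (sub_pos.2 hw.2).ne'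
    have hz : ‖(w : ℂ)‖ < 1 := by simpa [abs_of_pos hw.1] using hw.2
    have s := ((hasSum_deriv_hypergeometric A B C hz).sub
      ((hasSum_deriv_hypergeometric κ 1 1 hz).mul_left K)).tsum_eq
    have s' : ∑' n : ℕ, (((n : ℂ) + 1) * hgCoeff A B C (n + 1)
        - K * (((n : ℂ) + 1) * hgCoeff κ 1 1 (n + 1))) * (w : ℂ) ^ n
        = deriv (₂F₁ A B C) (w : ℂ) - K * deriv (₂F₁ κ 1 1) (w : ℂ) := by
      rw [← s]; congr 1; funext n; ring
    rw [s', deriv_ordinaryHypergeometric_one_one hz]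
    have e1 : ((1 : ℂ) - w) ^ (-κ - 1) = (((1 : ℂ) - w) ^ κ)⁻¹ * ((1 : ℂ) - w)⁻¹ := by
      rw [Complex.cpow_sub _ _ hx, Complex.cpow_neg, Complex.cpow_one, div_eq_mul_inv]
    have hk : ((1 : ℂ) - w) ^ κ ≠ 0 := fun h => hx ((Complex.cpow_eq_zero_iff _ _).1 h).1
    have e2 : ((1 : ℂ) - w) ^ (κ + 1) * deriv (₂F₁ A B C) (w : ℂ) - K * κ = ((1 : ℂ) - w) ^ κ *
        (((1 : ℂ) - w) * (deriv (₂F₁ A B C) (w : ℂ) - K * (κ * ((1 : ℂ) - w) ^ (-κ - 1)))) := by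
      rw [e1, Complex.cpow_add _ _ hx, Complex.cpow_one]
      field_simp
    rw [e2, norm_mul _ (_ * _), norm_ofReal_one_sub_cpow hκ hw.2, one_mul]
  simpa using h'.add_const (K * κ)

/-! ### Wronskians and the connection formula -/

/-- `f` is a holomorphic solution on `S` of the hypergeometric equation with parameters `A`, `B`,
`C`. -/
structure IsHypSol (A B C : ℂ) (f : ℂ → ℂ) (S : Set ℂ) : Prop where
  diff : DifferentiableOn ℂ f S
  eq : ∀ z ∈ S, HypEq A B C z (f z) (deriv f z) (deriv (deriv f) z)

/-- The Wronskian of `f` and `g`, multiplied by the weight `z ^ C * (1 - z) ^ (A + B - C + 1)` which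
makes it constant for two solutions of the hypergeometric equation. -/
noncomputable def hypWronskian (A B C : ℂ) (f g : ℂ → ℂ) (z : ℂ) : ℂ :=
  z ^ C * (1 - z) ^ (A + B - C + 1) * (f z * deriv g z - deriv f z * g z)

/-- The lens between the singular points `0` and `1` in which the expansions at both of them
converge. -/
def lens : Set ℂ := Metric.ball 0 1 ∩ Metric.ball 1 1

theorem isOpen_lens : IsOpen lens := Metric.isOpen_ball.inter Metric.isOpen_ball

theorem isPreconnected_lens : IsPreconnected lens :=
  ((convex_ball (0 : ℂ) 1).inter (convex_ball (1 : ℂ) 1)).isPreconnected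

theorem norm_lt_of_mem_lens {z : ℂ} (hz : z ∈ lens) : ‖z‖ < 1 := by simpa using hz.1

theorem norm_one_sub_lt_of_mem_lens {z : ℂ} (hz : z ∈ lens) : ‖1 - z‖ < 1 := by
  have := hz.2
  rwa [mem_ball_iff_norm'] at this

theorem mem_slitPlane_of_mem_lens {z : ℂ} (hz : z ∈ lens) : z ∈ Complex.slitPlane := by
  have := one_sub_mem_slitPlane_of_re_lt ((Complex.re_le_norm (1 - z)).trans_lt
      (norm_one_sub_lt_of_mem_lens hz))
  simpa using this

theorem one_sub_mem_slitPlane_of_mem_lens {z : ℂ} (hz : z ∈ lens) : 1 - z ∈ Complex.slitPlane :=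
  one_sub_mem_slitPlane_of_re_lt ((Complex.re_le_norm z).trans_lt (norm_lt_of_mem_lens hz))

theorem ofReal_mem_lens {w : ℝ} (h0 : 0 < w) (h1 : w < 1) : (w : ℂ) ∈ lens := by
  constructor
  · simpa [abs_of_pos h0] using h1
  · rw [mem_ball_iff_norm', ← Complex.ofReal_one, ← Complex.ofReal_sub, Complex.norm_real,
      Real.norm_of_nonneg (by linarith)]
    linarith

namespace IsHypSol

variable {A B C : ℂ} {f g : ℂ → ℂ} {S : Set ℂ}

theorem hasDerivAt (hf : IsHypSol A B C f S) (hS : IsOpen S) {z : ℂ} (hz : z ∈ S) :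
    HasDerivAt f (deriv f z) z :=
  (hf.diff.analyticOnNhd hS z hz).differentiableAt.hasDerivAt

theorem hasDerivAt_deriv (hf : IsHypSol A B C f S) (hS : IsOpen S) {z : ℂ} (hz : z ∈ S) :
    HasDerivAt (deriv f) (deriv (deriv f) z) z :=
  (hf.diff.analyticOnNhd hS z hz).deriv.differentiableAt.hasDerivAt

theorem hypWronskian_eq (hf : IsHypSol A B C f lens) (hg : IsHypSol A B C g lens) {z u : ℂ}
    (hz : z ∈ lens) (hu : u ∈ lens) : hypWronskian A B C f g z = hypWronskian A B C f g u := by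
  have hd : ∀ z ∈ lens, HasDerivAt (hypWronskian A B C f g) 0 z := by
    intro z hz
    have hs := mem_slitPlane_of_mem_lens hz
    have hs1 := one_sub_mem_slitPlane_of_mem_lens hz
    have h0 := Complex.slitPlane_ne_zero hs
    have h1 := Complex.slitPlane_ne_zero hs1
    have k1 := (hasDerivAt_id z).cpow_const (c := C) hs
    have k2 := ((hasDerivAt_id z).const_sub 1).cpow_const (c := A + B - C + 1) (by simpa using hs1)
    have k3 := ((hf.hasDerivAt isOpen_lens hz).mul (hg.hasDerivAt_deriv isOpen_lens hz)).sub
      ((hf.hasDerivAt_deriv isOpen_lens hz).mul (hg.hasDerivAt isOpen_lens hz))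
    refine ((k1.mul k2).mul k3).congr_deriv ?_
    have ef := hf.eq z hz
    have eg := hg.eq z hz
    unfold HypEq at ef eg
    simp only [id, Pi.mul_apply, Pi.sub_apply]
    rw [Complex.cpow_sub _ _ h0, add_sub_cancel_right, Complex.cpow_add _ _ h1, Complex.cpow_one,
      Complex.cpow_one]
    field_simp
    linear_combination (z ^ C * (1 - z) ^ (A + B - C)) * (f z * eg - g z * ef)
  exact isOpen_lens.is_const_of_deriv_eq_zero isPreconnected_lens
    (fun z hz => (hd z hz).differentiableAt.differentiableWithinAt)
        (fun z hz => (hd z hz).deriv) hz hu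

end IsHypSol

theorem isHypSol_hypergeometric {A B C : ℂ} (hC : ∀ n : ℕ, C + n ≠ 0) :
    IsHypSol A B C (₂F₁ A B C) lens :=
  ⟨(differentiableOn_hypergeometric A B C).mono inter_subset_left,
    fun _ hz => hypEq_hypergeometric hC (norm_lt_of_mem_lens hz)⟩

theorem differentiableAt_hypergeometric (A B C : ℂ) {z : ℂ} (hz : ‖z‖ < 1) :
    DifferentiableAt ℂ (₂F₁ A B C : ℂ → ℂ) z :=
        (hasDerivAt_hypergeometric A B C hz).differentiableAt

/-- The reflection `z ↦ 1 - z` exchanges the third exponent parameter `C` with `A + B - C + 1`. -/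
theorem isHypSol_hypergeometric_one_sub {A B C : ℂ} (hC : ∀ n : ℕ, A + B - C + 1 + n ≠ 0) :
    IsHypSol A B C (fun z => ₂F₁ A B (A + B - C + 1) (1 - z)) lens := by
  refine ⟨fun z hz => ?_, fun z hz => ?_⟩
  · exact ((differentiableAt_hypergeometric _ _ _ (norm_one_sub_lt_of_mem_lens hz)).comp z
      (by fun_prop)).differentiableWithinAt
  · have e1 : deriv (fun z : ℂ => ₂F₁ A B (A + B - C + 1) (1 - z))
        = fun z => -deriv (₂F₁ A B (A + B - C + 1)) (1 - z) :=
            funext fun z => deriv_comp_const_sub _ _ _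
    have e2 : deriv (fun z : ℂ => -deriv (₂F₁ A B (A + B - C + 1)) (1 - z)) z
        = deriv (deriv (₂F₁ A B (A + B - C + 1))) (1 - z) := by
      rw [deriv.fun_neg, deriv_comp_const_sub, neg_neg]
    have h := hypEq_hypergeometric (A := A) (B := B) hC (norm_one_sub_lt_of_mem_lens hz)
    rw [e1, e2]
    unfold HypEq at *
    linear_combination h

/-- Multiplication by `(1 - z) ^ (C - A - B)` carries solutions for the parameters `C - A`, `C - B`,
`C` to solutions for `A`, `B`, `C`. -/
theorem IsHypSol.cpow_mul {A B C : ℂ} {f : ℂ → ℂ} (hf : IsHypSol (C - A) (C - B) C f lens) :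
    IsHypSol A B C (fun z => (1 - z) ^ (C - A - B) * f z) lens := by
  have hp : ∀ {e p z : ℂ} {φ : ℂ → ℂ}, z ∈ lens → HasDerivAt φ p z →
      HasDerivAt (fun z => (1 - z) ^ e * φ z) (-e * ((1 - z) ^ (e - 1) * φ z) + (1 - z) ^ e
          * p) z := by
    intro e p z φ hz hφ
    have k := ((hasDerivAt_id z).const_sub 1).cpow_const (c := e)
      (by simpa using one_sub_mem_slitPlane_of_mem_lens hz)
    refine (k.mul hφ).congr_deriv ?_
    simp only [id]
    ring
  refine ⟨fun z hz => (hp hz (hf.hasDerivAt isOpen_lens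
      hz)).differentiableAt.differentiableWithinAt,
    fun z hz => ?_⟩
  set e := C - A - B with he
  have e1 : deriv (fun z => (1 - z) ^ e * f z) =ᶠ[𝓝 z] fun z =>
      -e * ((1 - z) ^ (e - 1) * f z) + (1 - z) ^ e * deriv f z := by
    filter_upwards [isOpen_lens.mem_nhds hz] with u hu
    exact (hp hu (hf.hasDerivAt isOpen_lens hu)).deriv
  have h2 : deriv (fun z => -e * ((1 - z) ^ (e - 1) * f z) + (1 - z) ^ e * deriv f z) z = _ :=
    (((hp (e := e - 1) hz (hf.hasDerivAt isOpen_lens hz)).const_mul (-e)).add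
    (hp (e := e) hz (hf.hasDerivAt_deriv isOpen_lens hz))).deriv
  rw [e1.deriv_eq, h2, e1.eq_of_nhds]
  have h1 := Complex.slitPlane_ne_zero (one_sub_mem_slitPlane_of_mem_lens hz)
  have p1 : (1 - z) ^ (e - 1) = (1 - z) ^ e / (1 - z) := by rw [Complex.cpow_sub _ _ h1,
      Complex.cpow_one]
  have p2 : (1 - z) ^ (e - 1 - 1) = (1 - z) ^ e / (1 - z) ^ 2 := by
    rw [Complex.cpow_sub _ _ h1, p1, Complex.cpow_one]; field_simp
  rw [p1, p2]
  have ode := hf.eq z hz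
  unfold HypEq at ode ⊢
  generalize (1 - z) ^ e = P at *
  field_simp
  rw [he]
  linear_combination (P * (1 - z)) * ode

theorem hypWronskian_cpow_mul {A B C : ℂ} {f g : ℂ → ℂ} {z : ℂ} (hz : z ∈ lens)
    (hf : DifferentiableAt ℂ f z) (hg : DifferentiableAt ℂ g z) :
    hypWronskian A B C (fun z => (1 - z) ^ (C - A - B) * f z) (fun z => (1 - z) ^ (C - A - B)
        * g z) z
      = hypWronskian (C - A) (C - B) C f g z := by
  have h1 := Complex.slitPlane_ne_zero (one_sub_mem_slitPlane_of_mem_lens hz)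
  have k := ((hasDerivAt_id z).const_sub 1).cpow_const (c := C - A - B)
      (by simpa using one_sub_mem_slitPlane_of_mem_lens hz)
  have kf : deriv (fun z => (1 - z) ^ (C - A - B) * f z) z = _ := (k.mul hf.hasDerivAt).deriv
  have kg : deriv (fun z => (1 - z) ^ (C - A - B) * g z) z = _ := (k.mul hg.hasDerivAt).deriv
  unfold hypWronskian
  rw [kf, kg]
  simp only [id]
  have e : (1 - z) ^ (C - A + (C - B) - C + 1)
      = (1 - z) ^ (A + B - C + 1) * ((1 - z) ^ (C - A - B) * (1 - z) ^ (C - A - B)) := by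
    rw [← Complex.cpow_add _ _ h1, ← Complex.cpow_add _ _ h1]
    congr 1; ring
  rw [e]
  ring

theorem tendsto_ofReal_one_sub : Tendsto (fun w : ℝ => (1 : ℂ) - w) (𝓝[<] 1) (𝓝 0) := by
  have : ContinuousAt (fun w : ℝ => (1 : ℂ) - w) 1 := by fun_prop
  simpa using this.tendsto.mono_left nhdsWithin_le_nhds

theorem tendsto_hypergeometric_one_sub (A B C : ℂ) :
    Tendsto (fun w : ℝ => ₂F₁ A B C ((1 : ℂ) - w)) (𝓝[<] 1) (𝓝 1) := by
  have h : ContinuousAt (₂F₁ A B C : ℂ → ℂ) 0 :=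
      (differentiableAt_hypergeometric A B C (by simp)).continuousAt
  simpa [Function.comp_def] using h.tendsto.comp tendsto_ofReal_one_sub

theorem tendsto_deriv_hypergeometric_one_sub (A B C : ℂ) :
    Tendsto (fun w : ℝ => deriv (₂F₁ A B C) ((1 : ℂ) - w)) (𝓝[<] 1) (𝓝 (deriv (₂F₁ A B C) 0)) :=
  (hasDerivAt_deriv_hypergeometric A B C (by simp)).continuousAt.tendsto.comp tendsto_ofReal_one_sub

theorem tendsto_ofReal_cpow_one (C : ℂ) : Tendsto (fun w : ℝ => (w : ℂ) ^ C) (𝓝[<] 1) (𝓝 1) := by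
  have : ContinuousAt (fun w : ℝ => (w : ℂ) ^ C) 1 :=
    ContinuousAt.cpow (by fun_prop) continuousAt_const (by simp)
  simpa using this.tendsto.mono_left nhdsWithin_le_nhds

/-- A weighted Wronskian of solutions which has a limit at the singular point `1` is equal to it. -/
theorem IsHypSol.hypWronskian_eq_of_tendsto {A B C l : ℂ} {f g : ℂ → ℂ} (hf : IsHypSol A B C f lens)
    (hg : IsHypSol A B C g lens)
    (h : Tendsto (fun w : ℝ => hypWronskian A B C f g (w : ℂ)) (𝓝[<] 1) (𝓝 l)) {z : ℂ}
        (hz : z ∈ lens) :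
    hypWronskian A B C f g z = l := by
  refine tendsto_nhds_unique (tendsto_const_nhds.congr' ?_) h
  filter_upwards [Ioo_mem_nhdsLT (zero_lt_one' ℝ)] with w hw
  exact hf.hypWronskian_eq hg hz (ofReal_mem_lens hw.1 hw.2)

theorem add_one_add_natCast_ne_zero {κ : ℂ} (hκ : κ.re = 0) (n : ℕ) : κ + 1 + n ≠ 0 := fun h => by
  have := congrArg Complex.re h
  simp [hκ] at this
  have := n.cast_nonneg (α := ℝ)
  linarith

theorem hypWronskian_one_sub_left {A B C : ℂ} (hC : ∀ n : ℕ, C + n ≠ 0) (hκ : (A + B - C).re = 0)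
    (hκ0 : A + B - C ≠ 0) {z : ℂ} (hz : z ∈ lens) :
    hypWronskian A B C (fun z => ₂F₁ A B (A + B - C + 1) (1 - z)) (₂F₁ A B C) z
      = Complex.Gamma C * Complex.Gamma (A + B - C) / (Complex.Gamma A * Complex.Gamma B) * (A
          + B - C) := by
  refine (isHypSol_hypergeometric_one_sub (add_one_add_natCast_ne_zero
      hκ)).hypWronskian_eq_of_tendsto
    (isHypSol_hypergeometric hC) ?_ hz
  have h1 := (tendsto_hypergeometric_one_sub A B (A + B - C + 1)).mul
    (tendsto_cpow_mul_deriv_hypergeometric hκ hκ0)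
  have h2 := (tendsto_deriv_hypergeometric_one_sub A B (A + B - C + 1)).mul
    (tendsto_cpow_mul_hypergeometric hκ)
  have h := (tendsto_ofReal_cpow_one C).mul (h1.add h2)
  rw [mul_zero, add_zero, one_mul, one_mul] at h
  refine h.congr fun w => ?_
  unfold hypWronskian
  rw [deriv_comp_const_sub]
  ring

theorem hypWronskian_one_sub_one_sub {A B C : ℂ} (hκ : (A + B - C).re = 0) {z : ℂ} (hz : z ∈ lens) :
    hypWronskian A B C (fun z => ₂F₁ A B (A + B - C + 1) (1 - z))
      (fun z => (1 - z) ^ (C - A - B) * ₂F₁ (C - A) (C - B) (C - A + (C - B) - C + 1) (1 - z)) z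
      = A + B - C := by
  have hκ' : (C - A + (C - B) - C).re = 0 := by
    simp at hκ ⊢; linarith
  refine (isHypSol_hypergeometric_one_sub (add_one_add_natCast_ne_zero
      hκ)).hypWronskian_eq_of_tendsto
    (isHypSol_hypergeometric_one_sub (add_one_add_natCast_ne_zero hκ')).cpow_mul ?_ hz
  set E := C - A + (C - B) - C + 1
  have a0 := tendsto_hypergeometric_one_sub A B (A + B - C + 1)
  have a1 := tendsto_deriv_hypergeometric_one_sub A B (A + B - C + 1)
  have b0 := tendsto_hypergeometric_one_sub (C - A) (C - B) E
  have b1 := tendsto_deriv_hypergeometric_one_sub (C - A) (C - B) E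
  have h := (tendsto_ofReal_cpow_one C).mul ((a0.mul ((b0.const_mul (A + B - C)).sub
    (tendsto_ofReal_one_sub.mul b1))).add (a1.mul (tendsto_ofReal_one_sub.mul b0)))
  simp only [mul_one, one_mul, zero_mul, sub_zero, mul_zero, add_zero] at h
  refine h.congr' ?_
  filter_upwards [Ioo_mem_nhdsLT (zero_lt_one' ℝ)] with w hw
  have hz := ofReal_mem_lens hw.1 hw.2
  have hx := Complex.slitPlane_ne_zero (one_sub_mem_slitPlane_of_mem_lens hz)
  have k := ((hasDerivAt_id (w : ℂ)).const_sub 1).cpow_const (c := C - A - B)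
      (by simpa using one_sub_mem_slitPlane_of_mem_lens hz)
  have kg : deriv (fun z : ℂ => (1 - z) ^ (C - A - B) * ₂F₁ (C - A) (C - B) E (1 - z)) (w : ℂ)
      = _ :=
    (k.mul ((differentiableAt_hypergeometric (C - A) (C - B) E
      (norm_one_sub_lt_of_mem_lens hz)).hasDerivAt.comp_const_sub 1 (w : ℂ))).deriv
  unfold hypWronskian
  rw [deriv_comp_const_sub, kg]
  simp only [id]
  have e1 : ((1 : ℂ) - w) ^ (C - A - B - 1) = ((1 : ℂ) - w) ^ (C - A - B) / (1 - w) := by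
    rw [Complex.cpow_sub _ _ hx, Complex.cpow_one]
  have e2 : ((1 : ℂ) - w) ^ (A + B - C + 1) = (((1 : ℂ) - w) ^ (C - A - B))⁻¹ * (1 - w) := by
    rw [Complex.cpow_add _ _ hx, Complex.cpow_one, ← Complex.cpow_neg]
    congr 2; ring
  rw [e1, e2]
  have : ((1 : ℂ) - w) ^ (C - A - B) ≠ 0 := fun h => hx ((Complex.cpow_eq_zero_iff _ _).1 h).1
  field_simp
  ring

/-- The connection formula between the singular points `0` and `1`, when the exponent difference
`C - A - B` at `1` is imaginary and not zero. -/
theorem hypergeometric_connection {A B C : ℂ} (hC : ∀ n : ℕ, C + n ≠ 0) (hκ : (A + B - C).re = 0)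
    (hκ0 : A + B - C ≠ 0) {z : ℂ} (hz : z ∈ lens) :
    ₂F₁ A B C z =
      Complex.Gamma C * Complex.Gamma (C - A - B) / (Complex.Gamma (C - A) * Complex.Gamma (C - B))
        * ₂F₁ A B (A + B - C + 1) (1 - z)
      + Complex.Gamma C * Complex.Gamma (A + B - C) / (Complex.Gamma A * Complex.Gamma B)
        * ((1 - z) ^ (C - A - B) * ₂F₁ (C - A) (C - B) (C - A - B + 1) (1 - z)) := by
  have hκe : C - A + (C - B) - C = C - A - B := by ring
  have hκ' : (C - A + (C - B) - C).re = 0 := by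
    simp at hκ ⊢; linarith
  have hκ0' : C - A + (C - B) - C ≠ 0 := fun h => hκ0 (by linear_combination -h)
  have w1 := hypWronskian_one_sub_left hC hκ hκ0 hz
  have w2 := hypWronskian_one_sub_one_sub hκ hz
  have w3 := hypWronskian_one_sub_left hC hκ' hκ0' hz
  rw [← hypWronskian_cpow_mul hz ((isHypSol_hypergeometric_one_sub
    (add_one_add_natCast_ne_zero hκ')).hasDerivAt isOpen_lens hz).differentiableAt
    (differentiableAt_hypergeometric _ _ _ (norm_lt_of_mem_lens hz))] at w3
  have eu : (fun z : ℂ => (1 - z) ^ (C - A - B) * ₂F₁ (C - A) (C - B) C z) =ᶠ[𝓝 z] ₂F₁ A B C := by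
    filter_upwards [isOpen_lens.mem_nhds hz] with u hu
    exact (euler_transformation hC (norm_lt_of_mem_lens hu)).symm
  unfold hypWronskian at w1 w2 w3
  rw [eu.deriv_eq, hκe] at w3
  rw [hκe] at w2
  beta_reduce at w1 w2 w3
  rw [← euler_transformation hC (norm_lt_of_mem_lens hz)] at w3
  generalize deriv (₂F₁ A B C : ℂ → ℂ) z = y0 at *
  generalize deriv (fun z : ℂ => (1 - z) ^ (C - A - B) * ₂F₁ (C - A) (C - B) (C - A - B + 1)
      (1 - z)) z
    = y2 at *
  generalize deriv (fun z : ℂ => ₂F₁ A B (A + B - C + 1) (1 - z)) z = y1 at *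
  refine mul_left_cancel₀ hκ0 ?_
  set f1 := ₂F₁ A B (A + B - C + 1) (1 - z)
  set f2 := (1 - z) ^ (C - A - B) * ₂F₁ (C - A) (C - B) (C - A - B + 1) (1 - z)
  linear_combination (-(₂F₁ A B C z)) * w2 - f1 * w3 + f2 * w1

/-! ### The expansion at the singular point `1` -/

/-- If the coefficient ratios of `₂F₁ A B C` satisfy `|c₁| x ≤ 1 / 8` and `|cₙ₊₁| x ≤ |cₙ| / 4`,
then the tail of the series is at most `(1 / 8) ∑ (1 / 4) ^ n = 1 / 6`. -/
theorem norm_hypergeometric_sub_one_le_of_ratio {A B C : ℂ} {x : ℝ} (hx0 : 0 ≤ x) (hx1 : x < 1)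
    (h0 : ‖A * B / C‖ * x ≤ 1 / 8)
    (h : ∀ n : ℕ, ‖(A + n) * (B + n) / ((C + n) * (n + 1))‖ * x ≤ 1 / 4) :
    ‖₂F₁ A B C (x : ℂ) - 1‖ ≤ 1 / 6 := by
  have hz : ‖(x : ℂ)‖ < 1 := by simpa [abs_of_nonneg hx0] using hx1
  have hs := (hasSum_nat_add_iff' 1).2 (hasSum_hypergeometric A B C hz)
  simp only [Finset.range_one, Finset.sum_singleton, hgCoeff_zero, pow_zero, mul_one] at hs
  have hb : ∀ n : ℕ, ‖hgCoeff A B C (n + 1) * (x : ℂ) ^ (n + 1)‖ ≤ 1 / 8 * (1 / 4) ^ n := by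
    intro n
    induction n with
    | zero =>
      rw [hgCoeff_succ, hgCoeff_zero]
      simpa [abs_of_nonneg hx0] using h0
    | succ n ih =>
      have e : hgCoeff A B C (n + 1 + 1) * (x : ℂ) ^ (n + 1 + 1) = (hgCoeff A B C (n + 1)
          * (x : ℂ) ^ (n + 1))
          * ((A + (n + 1 : ℕ)) * (B + (n + 1 : ℕ)) / ((C + (n + 1 : ℕ)) * ((n + 1 : ℕ) + 1))
            * x) := by
        rw [hgCoeff_succ (n + 1)]; ring
      have h1 := h (n + 1)
      rw [e, norm_mul, norm_mul _ (x : ℂ), Complex.norm_real, Real.norm_of_nonneg hx0]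
      calc _ ≤ (1 / 8 * (1 / 4) ^ n) * (1 / 4 : ℝ) := by gcongr
        _ = _ := by ring
  have hg : HasSum (fun n : ℕ => 1 / 8 * (1 / 4 : ℝ) ^ n) (1 / 6) := by
    have := (hasSum_geometric_of_lt_one (r := (1 / 4 : ℝ)) (by norm_num)
        (by norm_num)).mul_left (1 / 8)
    norm_num at this ⊢
    exact this
  rw [← hs.tsum_eq]
  exact tsum_of_norm_bounded hg hb

theorem abs_le_abs_add_abs_sq_sub_sq_div {t r : ℝ} (hr : 5 ≤ |r|) : |t| ≤ |r|
    + |t ^ 2 - r ^ 2| / 10 := by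
  by_cases h : |t| ≤ |r|
  · linarith [abs_nonneg (t ^ 2 - r ^ 2)]
  · push Not at h
    have h1 := le_abs_self (t ^ 2 - r ^ 2)
    rw [← sq_abs t, ← sq_abs r] at h1
    rw [← sq_abs t, ← sq_abs r]
    nlinarith

/-- The expansion at `1` of the solutions of the hypergeometric equation is close to its leading
term in the range `x ≤ 1 / (4 + |t² - r²|)`. -/
theorem norm_hypergeometric_sub_one_le {σ t r x : ℝ} (hσ : 1 / 2 ≤ σ) (hσ1 : σ ≤ 1) (hr : 5 ≤ |r|)
    (hx0 : 0 ≤ x) (hx : x * (4 + |t ^ 2 - r ^ 2|) ≤ 1) :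
    ‖₂F₁ (((σ + Complex.I * t) + Complex.I * r) / 2) ((1 - (σ + Complex.I * t) + Complex.I * r) / 2)
      (1 + Complex.I * r) (x : ℂ) - 1‖ ≤ 1 / 6 := by
  set D := |t ^ 2 - r ^ 2| with hD
  have hD0 : 0 ≤ D := abs_nonneg _
  have hD1 := abs_le.1 hD.ge
  have htD : |t| ≤ |r| + D / 10 := abs_le_abs_add_abs_sq_sub_sq_div hr
  have hR : |r| ^ 2 = r ^ 2 := sq_abs r
  have hx' : x ≤ (4 + D)⁻¹ := by rwa [← one_div, le_div_iff₀ (by positivity)]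
  -- four times the numerator of a coefficient ratio has real part `X` and imaginary part `Y`
  set X : ℝ → ℝ := fun k => σ * (1 - σ) + t ^ 2 - r ^ 2 + 2 * k + 4 * k ^ 2 with hX
  set Y : ℝ → ℝ := fun k => r + 4 * k * r - t * (2 * σ - 1) with hY
  have num : ∀ k : ℝ, ‖(((σ + Complex.I * t) + Complex.I * r) / 2 + k)
      * ((1 - (σ + Complex.I * t) + Complex.I * r) / 2 + k)‖ = √(X k ^ 2 + Y k ^ 2) / 4 := by
    intro k
    have : (((σ + Complex.I * t) + Complex.I * r) / 2 + k) * ((1 - (σ + Complex.I * t) + Complex.I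
        * r) / 2 + k)
        = ((X k : ℝ) + (Y k : ℝ) * Complex.I) / 4 := by
      simp only [hX, hY]
      push_cast
      linear_combination ((-t ^ 2 + r ^ 2) / 4 : ℂ) * Complex.I_sq
    rw [this, norm_div, Complex.norm_add_mul_I]
    norm_num
  have den : ∀ k : ℝ, ‖(1 + Complex.I * r + k : ℂ)‖ = √((1 + k) ^ 2 + r ^ 2) := by
    intro k
    rw [← Complex.norm_add_mul_I]
    congr 1; push_cast; ring
  have hYb : ∀ k : ℝ, 0 ≤ k → |Y k| ≤ |r| + 4 * k * |r| + |t| := by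
    intro k hk
    have h2 : |t * (2 * σ - 1)| ≤ |t| := by
      rw [abs_mul, abs_of_nonneg (by linarith : (0 : ℝ) ≤ 2 * σ - 1)]
      nlinarith [abs_nonneg t]
    calc |Y k| ≤ |r + 4 * k * r| + |t * (2 * σ - 1)| := abs_sub _ _
      _ ≤ |r| + |4 * k * r| + |t| := add_le_add (abs_add_le _ _) h2
      _ = _ := by rw [abs_mul, abs_of_nonneg (by linarith : (0 : ℝ) ≤ 4 * k)]
  have hXb : ∀ k : ℝ, 0 ≤ k → |X k| ≤ D + 1 / 4 + 2 * k + 4 * k ^ 2 := by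
    intro k hk
    simp only [hX]
    rw [abs_le]
    constructor <;> nlinarith [sq_nonneg (σ - 1 / 2), mul_nonneg (by linarith : 0 ≤ σ)
        (by linarith : 0 ≤ 1 - σ)]
  refine norm_hypergeometric_sub_one_le_of_ratio hx0 ?_ ?_ ?_
  · nlinarith
  · have n0 := num 0
    have d0 := den 0
    simp only [Complex.ofReal_zero, add_zero] at n0 d0
    rw [norm_div, n0, d0]
    have key : √(X 0 ^ 2 + Y 0 ^ 2) ≤ (4 + D) * √(1 ^ 2 + r ^ 2) / 2 := by
      refine Real.sqrt_le_iff.2 ⟨by positivity, ?_⟩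
      rw [div_pow, mul_pow, Real.sq_sqrt (by positivity)]
      have a1 := hXb 0 le_rfl
      have a2 : |Y 0| ≤ 2 * |r| + D / 10 := (hYb 0 le_rfl).trans (by linarith)
      have b1 : X 0 ^ 2 ≤ (D + 1 / 4) ^ 2 := by
        rw [← sq_abs]; gcongr; linarith
      have b2 : Y 0 ^ 2 ≤ (2 * |r| + D / 10) ^ 2 := by
        rw [← sq_abs]; gcongr
      rw [← hR]
      have : (D + 1 / 4) ^ 2 + (2 * |r| + D / 10) ^ 2
          ≤ (4 + D) ^ 2 * (1 ^ 2 + |r| ^ 2) / 2 ^ 2 := by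
        have c1 : 25 ≤ |r| ^ 2 := by nlinarith
        have c2 := mul_nonneg hD0 (by nlinarith : 0 ≤ |r| ^ 2 - |r|)
        have c3 := mul_nonneg (mul_nonneg hD0 hD0) (by linarith : 0 ≤ |r| ^ 2 - 25)
        have c4 := mul_nonneg hD0 (by linarith : 0 ≤ |r| ^ 2 - 25)
        nlinarith
      linarith
    have hs : 0 < √(1 ^ 2 + r ^ 2) := by positivity
    calc _ ≤ ((4 + D) * √(1 ^ 2 + r ^ 2) / 2) / 4 / √(1 ^ 2 + r ^ 2) * (4 + D)⁻¹ := by gcongr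
      _ = 1 / 8 := by field_simp; norm_num
  · intro n
    have hk : (0 : ℝ) ≤ n := n.cast_nonneg
    have n0 := num n
    have d0 := den n
    simp only [Complex.ofReal_natCast] at n0 d0
    have e1 : ‖(n : ℂ) + 1‖ = n + 1 := by
      have := Complex.norm_natCast (n + 1)
      push_cast at this; exact this
    rw [norm_div, norm_mul (_ + _ : ℂ) ((n : ℂ) + 1), n0, d0, e1]
    generalize (n : ℝ) = k at *
    have key : √(X k ^ 2 + Y k ^ 2) ≤ (4 + D) * ((k + 1) * √((1 + k) ^ 2 + r ^ 2)) := by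
      refine Real.sqrt_le_iff.2 ⟨by positivity, ?_⟩
      rw [mul_pow, mul_pow, Real.sq_sqrt (by positivity)]
      have a1 : |X k| ≤ (4 + D) * (k + 1) ^ 2 := (hXb k hk).trans (by nlinarith [mul_nonneg hD0 hk])
      have a2 : |Y k| ≤ (4 + D) * ((k + 1) * |r|) := by
        refine (hYb k hk).trans ?_
        nlinarith [mul_nonneg (mul_nonneg hD0 hk) (abs_nonneg r), mul_nonneg hD0 (by linarith : 0
            ≤ |r| - 5)]
      have b1 : X k ^ 2 ≤ ((4 + D) * (k + 1) ^ 2) ^ 2 := by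
        rw [← sq_abs]; gcongr
      have b2 : Y k ^ 2 ≤ ((4 + D) * ((k + 1) * |r|)) ^ 2 := by
        rw [← sq_abs]; gcongr
      rw [← hR]
      calc _ ≤ _ := add_le_add b1 b2
        _ = _ := by ring
    have hs : 0 < √((1 + k) ^ 2 + r ^ 2) := by positivity
    have hk1 : 0 < k + 1 := by linarith
    calc _ ≤ ((4 + D) * ((k + 1) * √((1 + k) ^ 2 + r ^ 2))) / 4 / (√((1 + k) ^ 2 + r ^ 2) * (k + 1))
          * (4 + D)⁻¹ := by gcongr
      _ = 1 / 4 := by field_simp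

/-! ### A lower bound for quotients of the Gamma function on a horizontal line -/

/-- A Padé sharpening of Bernoulli's inequality for exponents in `[0, 1]`. -/
theorem one_add_pade_le_rpow {q z : ℝ} (hq0 : 0 ≤ q) (hq1 : q ≤ 1) (hz : 0 ≤ z) :
    1 + 2 * q * z / (2 + (1 - q) * z) ≤ (1 + z) ^ q := by
  set f : ℝ → ℝ := fun z => q * Real.log (1 + z) - Real.log (2 + (1 + q) * z) + Real.log (2
      + (1 - q) * z)
    with hf
  have p1 : ∀ z : ℝ, 0 ≤ z → 0 < 2 + (1 + q) * z := fun z hz => by positivity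
  have p2 : ∀ z : ℝ, 0 ≤ z → 0 < 2 + (1 - q) * z := fun z hz => by
    have := mul_nonneg (sub_nonneg.2 hq1) hz; linarith
  have hd : ∀ z : ℝ, 0 ≤ z → HasDerivAt f
      (q * (1 / (1 + z)) - (1 + q) / (2 + (1 + q) * z) + (1 - q) / (2 + (1 - q) * z)) z := by
    intro z hz
    have a0 : HasDerivAt (fun z : ℝ => 1 + z) 1 z := (hasDerivAt_id z).const_add 1
    have a1 : HasDerivAt (fun z : ℝ => 2 + (1 + q) * z) (1 + q) z := by
      simpa using ((hasDerivAt_id z).const_mul (1 + q)).const_add 2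
    have a2 : HasDerivAt (fun z : ℝ => 2 + (1 - q) * z) (1 - q) z := by
      simpa using ((hasDerivAt_id z).const_mul (1 - q)).const_add 2
    exact (((a0.log (by positivity)).const_mul q).sub (a1.log (p1 z hz).ne')).add (a2.log (p2 z
        hz).ne')
  have hmono : MonotoneOn f (Ici 0) := by
    refine monotoneOn_of_deriv_nonneg (convex_Ici 0)
      (fun z hz => (hd z hz).continuousAt.continuousWithinAt)
      (fun z hz => (hd z (interior_subset hz)).differentiableAt.differentiableWithinAt) fun z hz =>
          ?_
    have hz : 0 ≤ z := interior_subset hz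
    rw [(hd z hz).deriv]
    have h1 := p1 z hz
    have h2 := p2 z hz
    have e : q * (1 / (1 + z)) - (1 + q) / (2 + (1 + q) * z) + (1 - q) / (2 + (1 - q) * z)
        = q * (z ^ 2 * ((1 - q) * (1 + q))) / ((1 + z) * (2 + (1 + q) * z) * (2 + (1 - q)
          * z)) := by
      have h0 : 0 < 1 + z := by positivity
      rw [mul_one_div, div_sub_div _ _ h0.ne' h1.ne', div_add_div _ _ (mul_pos h0 h1).ne' h2.ne']
      congr 1
      ring
    rw [e]
    have := sub_nonneg.2 hq1
    positivity
  have h := hmono self_mem_Ici hz hz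
  have h1 := p1 z hz
  have h2 := p2 z hz
  simp only [hf, mul_zero, add_zero, Real.log_one, zero_sub, neg_add_cancel] at h
  have e : 1 + 2 * q * z / (2 + (1 - q) * z) = (2 + (1 + q) * z) / (2 + (1 - q) * z) := by
    rw [eq_div_iff h2.ne', add_mul, div_mul_cancel₀ _ h2.ne']; ring
  rw [e, ← Real.log_le_log_iff (by positivity) (by positivity), Real.log_div h1.ne' h2.ne',
    Real.log_rpow (by positivity)]
  linarith

theorem norm_sq_GammaSeq (s y : ℝ) {n : ℕ} (hn : n ≠ 0) :
    ‖Complex.GammaSeq (s + y * Complex.I) n‖ ^ 2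
      = ((n : ℝ) ^ 2) ^ s * (n.factorial : ℝ) ^ 2 / ∏ j ∈ Finset.range (n + 1), ((s + j) ^ 2
          + y ^ 2) := by
  have hn' : (0 : ℝ) < n := by exact_mod_cast Nat.pos_of_ne_zero hn
  rw [Complex.GammaSeq, norm_div, norm_mul,
      Complex.norm_natCast_cpow_of_pos (Nat.pos_of_ne_zero hn),
    Complex.norm_natCast, norm_prod, div_pow, mul_pow, ← Finset.prod_pow]
  congr 1
  · congr 1
    simp only [Complex.add_re, Complex.ofReal_re, Complex.mul_re, Complex.I_re, mul_zero,
        Complex.ofReal_im,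
      Complex.I_im, mul_one, sub_self, add_zero]
    rw [← Real.rpow_natCast, ← Real.rpow_natCast, ← Real.rpow_mul hn'.le, ← Real.rpow_mul hn'.le,
        mul_comm]
  · refine Finset.prod_congr rfl fun j _ => ?_
    have : (s + y * Complex.I + j : ℂ) = ((s + j : ℝ) : ℂ) + y * Complex.I := by push_cast; ring
    rw [this, Complex.norm_add_mul_I, Real.sq_sqrt (by positivity)]

/-- Up to the constant `1 / 4` this is Stirling's order of growth. The `j`-th factors of the Euler
products of the two sides are compared with `(g (j + 1) / g j) ^ q`, where
`g j = (j + v + (q - 1) / 2) ^ 2 + (y ^ 2 - 1 / 4)`; their product telescopes. -/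
theorem rpow_mul_norm_Gamma_le {v q y : ℝ} (hv : 0 ≤ v) (hq0 : 0 ≤ q) (hq1 : q ≤ 1)
    (hy : 1 / 4 < y ^ 2) :
    (y ^ 2 - 1 / 4) ^ q * ‖Complex.Gamma (v + y * Complex.I)‖ ^ 2
      ≤ ‖Complex.Gamma ((v + q : ℝ) + y * Complex.I)‖ ^ 2 := by
  set β := y ^ 2 - 1 / 4 with hβ
  have hβ0 : 0 < β := by linarith
  set g : ℝ → ℝ := fun j => (j + (v + (q - 1) / 2)) ^ 2 + β with hg
  have gpos : ∀ j, 0 < g j := fun j => by positivity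
  have step : ∀ j : ℕ, (v + q + j) ^ 2 + y ^ 2 ≤ ((v + j) ^ 2 + y ^ 2) * (g (j + 1) / g j) ^ q := by
    intro j
    have hj : (0 : ℝ) ≤ j := j.cast_nonneg
    generalize (j : ℝ) = j at *
    have hw : 0 < (v + j) ^ 2 + y ^ 2 := by nlinarith [sq_nonneg (v + j)]
    have hgj := gpos j
    set z := (2 * j + 2 * v + q) / g j with hz
    have hz0 : 0 ≤ z := by positivity
    have e : g (j + 1) / g j = 1 + z := by
      rw [hz]
      field_simp
      simp only [hg]
      ring
    have hp : 0 < 2 + (1 - q) * z := by nlinarith [mul_nonneg (sub_nonneg.2 hq1) hz0]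
    have e2 : 2 * q * z / (2 + (1 - q) * z)
        = q * (2 * j + 2 * v + q) / (g j + (1 - q) * (2 * j + 2 * v + q) / 2) := by
      have hp2 : 0 < g j + (1 - q) * (2 * j + 2 * v + q) / 2 := by
        have := mul_nonneg (sub_nonneg.2 hq1) (by positivity : 0 ≤ 2 * j + 2 * v + q)
        linarith
      have hp' : 0 < 2 + (1 - q) * ((2 * j + 2 * v + q) / g j) := hp
      rw [hz, div_eq_div_iff hp'.ne' hp2.ne']
      field_simp
    -- the shift in `g` is chosen so that the terms in `j` on the two sides cancel
    have hle : g j + (1 - q) * (2 * j + 2 * v + q) / 2 ≤ (v + j) ^ 2 + y ^ 2 := by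
      simp only [hg, hβ]
      nlinarith
    have hp2 : 0 < g j + (1 - q) * (2 * j + 2 * v + q) / 2 := by
      have := mul_nonneg (sub_nonneg.2 hq1) (by positivity : 0 ≤ 2 * j + 2 * v + q)
      linarith
    calc (v + q + j) ^ 2 + y ^ 2
        = ((v + j) ^ 2 + y ^ 2) * (1 + q * (2 * j + 2 * v + q) / ((v + j) ^ 2 + y ^ 2)) := by
          field_simp; ring
      _ ≤ ((v + j) ^ 2 + y ^ 2) * (1 + 2 * q * z / (2 + (1 - q) * z)) := by
          rw [e2]; gcongr
      _ ≤ _ := by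
          rw [e]
          gcongr
          exact one_add_pade_le_rpow hq0 hq1 hz0
  have prod : ∀ n : ℕ, ∏ j ∈ Finset.range n, ((v + q + j) ^ 2 + y ^ 2)
      ≤ (∏ j ∈ Finset.range n, ((v + j) ^ 2 + y ^ 2)) * (g n / g 0) ^ q := by
    intro n
    induction n with
    | zero => simp [(gpos 0).ne']
    | succ n ih =>
      rw [Finset.prod_range_succ, Finset.prod_range_succ]
      have h0 := gpos 0
      have hn := gpos n
      have hn1 := gpos (n + 1)
      have e : (g (n + 1 : ℕ) / g 0) ^ q = (g n / g 0) ^ q * (g (n + 1) / g n) ^ q := by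
        rw [← Real.mul_rpow (by positivity) (by positivity)]
        congr 1
        push_cast
        field_simp
      rw [e]
      calc _ ≤ ((∏ j ∈ Finset.range n, ((v + j) ^ 2 + y ^ 2)) * (g n / g 0) ^ q)
            * (((v + n) ^ 2 + y ^ 2) * (g (n + 1) / g n) ^ q) :=
            mul_le_mul ih (step n) (by positivity) (by positivity)
        _ = _ := by ring
  have seq : ∀ᶠ n : ℕ in atTop, ((n : ℝ) ^ 2 / g ((n + 1 : ℕ) : ℝ)) ^ q * (β ^ q
      * ‖Complex.GammaSeq (v + y * Complex.I) n‖ ^ 2) ≤ ‖Complex.GammaSeq ((v + q : ℝ) + y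
          * Complex.I) n‖ ^ 2 := by
    filter_upwards [eventually_ne_atTop 0] with n hn
    have hn' : (0 : ℝ) < n := by exact_mod_cast Nat.pos_of_ne_zero hn
    rw [norm_sq_GammaSeq v y hn, norm_sq_GammaSeq (v + q) y hn, Real.rpow_add (by positivity)]
    have hy2 : 0 < y ^ 2 := by linarith
    have P0 : 0 < ∏ j ∈ Finset.range (n + 1), ((v + j) ^ 2 + y ^ 2) :=
      Finset.prod_pos fun j _ => by positivity
    have P1 : 0 < ∏ j ∈ Finset.range (n + 1), ((v + q + j) ^ 2 + y ^ 2) :=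
      Finset.prod_pos fun j _ => by positivity
    have hp := prod (n + 1)
    have hg0 : β ≤ g 0 := by simp only [hg]; nlinarith [sq_nonneg (0 + (v + (q - 1) / 2))]
    have hG := gpos ((n + 1 : ℕ) : ℝ)
    have G0 := gpos 0
    rw [Real.div_rpow (by positivity) hG.le]
    rw [Real.div_rpow hG.le G0.le] at hp
    have hGq : 0 < g ((n + 1 : ℕ) : ℝ) ^ q := by positivity
    have G0q : 0 < g 0 ^ q := by positivity
    have hβq : β ^ q ≤ g 0 ^ q := by gcongr
    generalize ∏ j ∈ Finset.range (n + 1), ((v + j) ^ 2 + y ^ 2) = Pv at *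
    generalize ∏ j ∈ Finset.range (n + 1), ((v + q + j) ^ 2 + y ^ 2) = Pu at *
    generalize g ((n + 1 : ℕ) : ℝ) ^ q = G at *
    have hN : 0 < ((n : ℝ) ^ 2) ^ q := by positivity
    have hNv : 0 < ((n : ℝ) ^ 2) ^ v := by positivity
    rw [le_div_iff₀ P1]
    calc _ ≤ ((n : ℝ) ^ 2) ^ q / G * (β ^ q * (((n : ℝ) ^ 2) ^ v * (n.factorial : ℝ) ^ 2 / Pv))
          * (Pv * (G / g 0 ^ q)) := by gcongr
      _ = (β ^ q / g 0 ^ q) * (((n : ℝ) ^ 2) ^ v * ((n : ℝ) ^ 2) ^ q * (n.factorial : ℝ) ^ 2) := by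
          field_simp
      _ ≤ 1 * (((n : ℝ) ^ 2) ^ v * ((n : ℝ) ^ 2) ^ q * (n.factorial : ℝ) ^ 2) := by
          gcongr
          exact (div_le_one G0q).2 hβq
      _ = _ := one_mul _
  have lim1 : Tendsto (fun n : ℕ => ((n : ℝ) ^ 2 / g ((n + 1 : ℕ) : ℝ)) ^ q) atTop (𝓝 1) := by
    have h1 : Tendsto (fun n : ℕ => g ((n + 1 : ℕ) : ℝ) / (n : ℝ) ^ 2) atTop (𝓝 1) := by
      have i0 := tendsto_one_div_atTop_nhds_zero_nat (𝕜 := ℝ)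
      have i1 := ((i0.const_mul (1 + (v + (q - 1) / 2))).const_add 1).pow 2
      have i2 := (i0.pow 2).const_mul β
      have i3 := i1.add i2
      simp only [mul_zero, add_zero, one_pow, ne_eq, OfNat.ofNat_ne_zero, not_false_eq_true,
          zero_pow] at i3
      refine i3.congr' ?_
      filter_upwards [eventually_ne_atTop 0] with n hn
      have hn' : (n : ℝ) ≠ 0 := by exact_mod_cast hn
      simp only [hg]
      push_cast
      field_simp
      ring
    have h2 := h1.inv₀ one_ne_zero
    have h3 := h2.rpow_const (p := q) (Or.inl (by norm_num))
    simp only [inv_div, inv_one, Real.one_rpow] at h3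
    exact h3
  have l2 := (Complex.GammaSeq_tendsto_Gamma (v + y * Complex.I)).norm.pow 2
  have l3 := (Complex.GammaSeq_tendsto_Gamma ((v + q : ℝ) + y * Complex.I)).norm.pow 2
  have := le_of_tendsto_of_tendsto (lim1.mul (l2.const_mul (β ^ q))) l3 seq
  rwa [one_mul] at this

theorem norm_sq_Gamma_I_mul {r : ℝ} (hr : 0 < r) :
    ‖Complex.Gamma (Complex.I * r)‖ ^ 2 = Real.pi / (r * Real.sinh (Real.pi * r)) := by
  have hr0 : (Complex.I * r : ℂ) ≠ 0 := by simp [hr.ne']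
  have h := Complex.Gamma_mul_Gamma_one_sub (Complex.I * r)
  have e1 : (1 : ℂ) - Complex.I * r = -(Complex.I * r) + 1 := by ring
  have e2 : (starRingEnd ℂ) (Complex.I * r) = -(Complex.I * r) := by simp
  have e3 : (Real.pi : ℂ) * (Complex.I * r) = ((Real.pi * r : ℝ) : ℂ) * Complex.I :=
      by push_cast; ring
  rw [e1, Complex.Gamma_add_one _ (neg_ne_zero.2 hr0), ← e2, Complex.Gamma_conj, e3,
      Complex.sin_mul_I,
    ← Complex.ofReal_sinh] at h
  have hs : 0 < Real.sinh (Real.pi * r) := Real.sinh_pos_iff.2 (by positivity)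
  have h' := congrArg norm h
  rw [norm_mul, norm_mul, RCLike.norm_conj, RCLike.norm_conj, norm_mul, norm_div, norm_mul,
      Complex.norm_I,
    Complex.norm_real, Complex.norm_real, Complex.norm_real, Real.norm_of_nonneg hr.le,
    Real.norm_of_nonneg Real.pi_pos.le, Real.norm_of_nonneg hs.le] at h'
  field_simp at h' ⊢
  linarith

/-! ### The lower bound -/

theorem half_add_natCast_add_natCast_ne_zero (ε n : ℕ) : (1 / 2 + ε : ℂ) + n ≠ 0 := fun h => by
  have := congrArg Complex.re h
  simp at this
  have h1 := n.cast_nonneg (α := ℝ)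
  have h2 := ε.cast_nonneg (α := ℝ)
  norm_num at this
  linarith

/-- The norm of the twisted factor, after Pfaff's transformation of its hypergeometric function. -/
theorem norm_twistedGamma {N : ℕ} (hN : 1 ≤ N) {w : ℂ} (hw : ‖w‖ = 1) (ε : ℕ) (r : ℝ) {θ : ℝ}
    (hθ : 0 < Real.cos θ) (s : ℂ) :
    ‖twistedGamma N w ε r θ s‖ = (Real.cos θ / √N) ^ (1 / 2 - s.re)
      * ‖Complex.Gammaℝ (s + ε + Complex.I * r)‖ * ‖Complex.Gammaℝ (s + ε - Complex.I * r)‖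
      * (Real.cos θ ^ (s.re + ε) * ‖₂F₁ ((s + ε + Complex.I * r) / 2) ((1 - s + ε + Complex.I
          * r) / 2)
        (1 / 2 + ε) ((1 - Real.cos θ ^ 2 : ℝ) : ℂ)‖) := by
  have hN' : (0 : ℝ) < N := by exact_mod_cast hN
  have hw0 : w ≠ 0 := fun h => by simp [h] at hw
  have hC := half_add_natCast_add_natCast_ne_zero ε
  have e1 : 1 + Real.tan θ ^ 2 = (Real.cos θ ^ 2)⁻¹ :=
      (Real.inv_one_add_tan_sq hθ.ne' ▸ (inv_inv _).symm)
  have e2 : Real.tan θ ^ 2 / (1 + Real.tan θ ^ 2) = 1 - Real.cos θ ^ 2 := by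
    have : Real.tan θ ^ 2 = (Real.cos θ ^ 2)⁻¹ - 1 := by linarith
    rw [e1, this]
    field_simp
  have e3 : (1 / 2 + ε : ℂ) - (s + ε - Complex.I * r) / 2 = (1 - s + ε + Complex.I * r) / 2 :=
      by ring
  have e4 : ((Real.tan θ : ℝ) : ℂ) ^ 2 = ((Real.tan θ ^ 2 : ℝ) : ℂ) := by push_cast; rfl
  have nw : ‖w ^ (-(1 / 2) : ℂ)‖ = 1 := by
    have : (-(1 / 2) : ℂ) = ((-(1 / 2) : ℝ) : ℂ) := by push_cast; rfl
    rw [this, Complex.norm_cpow_real, hw, Real.one_rpow]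
  unfold twistedGamma
  rw [e4, hyp2F1_neg_eq hC (sq_nonneg _), e2, e3, e1, norm_mul, norm_mul, norm_mul, norm_mul,
      norm_mul, norm_mul,
    nw, norm_zpow, Complex.norm_I, one_zpow, one_mul, one_mul,
        Complex.norm_cpow_eq_rpow_re_of_pos (by positivity),
    Complex.norm_cpow_eq_rpow_re_of_pos (by positivity)]
  have e5 : ((Real.cos θ ^ 2)⁻¹) ^ (-((s + ε + Complex.I * r) / 2)).re
      = Real.cos θ ^ (s.re + ε) := by
    rw [Real.inv_rpow (by positivity), ← Real.rpow_neg (by positivity), ← Real.rpow_natCast,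
      ← Real.rpow_mul hθ.le]
    congr 1
    simp
    ring
  rw [e5]
  simp

/-- Two points at which the relative phase of two oscillating terms differs by `π`: by the
parallelogram law the terms cannot nearly cancel at both. -/
theorem le_max_norm_add_norm_sub {α β u₁ u₂ v₁ v₂ : ℂ} (hu₁ : ‖u₁ - 1‖ ≤ 1 / 6) (hu₂ : ‖u₂ - 1‖
    ≤ 1 / 6)
    (hv₁ : ‖v₁ - 1‖ ≤ 1 / 6) (hv₂ : ‖v₂ - 1‖ ≤ 1 / 6) :
    (1 - √2 / 6) * √(‖α‖ ^ 2 + ‖β‖ ^ 2) ≤ max ‖α * u₁ + β * v₁‖ ‖α * u₂ - β * v₂‖ := by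
  set K := max ‖α * u₁ + β * v₁‖ ‖α * u₂ - β * v₂‖
  set S := √(‖α‖ ^ 2 + ‖β‖ ^ 2) with hS
  have hS0 : 0 ≤ S := Real.sqrt_nonneg _
  have hS2 : S ^ 2 = ‖α‖ ^ 2 + ‖β‖ ^ 2 := Real.sq_sqrt (by positivity)
  have err : ∀ {γ u : ℂ}, ‖u - 1‖ ≤ 1 / 6 → ‖γ * (u - 1)‖ ≤ ‖γ‖ / 6 := fun {γ u} h => by
    rw [norm_mul]
    nlinarith [norm_nonneg γ]
  have h1 : ‖α + β‖ ≤ K + (‖α‖ + ‖β‖) / 6 := by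
    have : α + β = (α * u₁ + β * v₁) - α * (u₁ - 1) - β * (v₁ - 1) := by ring
    rw [this]
    have := norm_sub_le ((α * u₁ + β * v₁) - α * (u₁ - 1)) (β * (v₁ - 1))
    have := norm_sub_le (α * u₁ + β * v₁) (α * (u₁ - 1))
    have := err (γ := α) hu₁
    have := err (γ := β) hv₁
    have : ‖α * u₁ + β * v₁‖ ≤ K := le_max_left _ _
    linarith
  have h2 : ‖α - β‖ ≤ K + (‖α‖ + ‖β‖) / 6 := by
    have : α - β = (α * u₂ - β * v₂) - α * (u₂ - 1) + β * (v₂ - 1) := by ring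
    rw [this]
    have := norm_add_le ((α * u₂ - β * v₂) - α * (u₂ - 1)) (β * (v₂ - 1))
    have := norm_sub_le (α * u₂ - β * v₂) (α * (u₂ - 1))
    have := err (γ := α) hu₂
    have := err (γ := β) hv₂
    have : ‖α * u₂ - β * v₂‖ ≤ K := le_max_right _ _
    linarith
  have hK : 0 ≤ K := (norm_nonneg _).trans (le_max_left _ _)
  have par := parallelogram_law_with_norm ℝ α β
  have h3 : S ≤ K + (‖α‖ + ‖β‖) / 6 := by
    refine le_of_sq_le_sq ?_ (by positivity)
    have a1 : ‖α + β‖ ^ 2 ≤ (K + (‖α‖ + ‖β‖) / 6) ^ 2 := by gcongr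
    have a2 : ‖α - β‖ ^ 2 ≤ (K + (‖α‖ + ‖β‖) / 6) ^ 2 := by gcongr
    nlinarith
  have h4 : ‖α‖ + ‖β‖ ≤ √2 * S := by
    refine le_of_sq_le_sq ?_ (by positivity)
    rw [mul_pow, Real.sq_sqrt (by norm_num), hS2]
    nlinarith [sq_nonneg (‖α‖ - ‖β‖)]
  nlinarith

/-- The connection formula for the parameters of the twisted factor. By Euler's transformation both
local solutions at `1` are `(1 - x) ^ (-ε / 2)` times functions which do not depend on `ε`. -/
theorem twisted_connection {ε : ℕ} (hε : ε = 0 ∨ ε = 1) {r : ℝ} (hr : r ≠ 0) (s : ℂ) {x : ℝ}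
    (hx0 : 0 < x)
    (hx1 : x < 1) :
    ₂F₁ ((s + ε + Complex.I * r) / 2) ((1 - s + ε + Complex.I * r) / 2) (1 / 2 + ε)
        ((1 - x : ℝ) : ℂ)
      = ((1 - x : ℝ) : ℂ) ^ (-(ε : ℂ) / 2) *
        (Complex.Gamma (1 / 2 + ε) * Complex.Gamma (-(Complex.I * r))
          / (Complex.Gamma ((1 - s + ε - Complex.I * r) / 2) * Complex.Gamma ((s + ε - Complex.I
              * r) / 2))
          * ₂F₁ ((s + Complex.I * r) / 2) ((1 - s + Complex.I * r) / 2) (1 + Complex.I * r) (x : ℂ)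
        + Complex.Gamma (1 / 2 + ε) * Complex.Gamma (Complex.I * r)
          / (Complex.Gamma ((s + ε + Complex.I * r) / 2) * Complex.Gamma ((1 - s + ε + Complex.I
              * r) / 2))
          * (x : ℂ) ^ (-(Complex.I * r))
          * ₂F₁ ((s - Complex.I * r) / 2) ((1 - s - Complex.I * r) / 2) (1 - Complex.I * r)
              (x : ℂ)) := by
  have hC := half_add_natCast_add_natCast_ne_zero ε
  have hI : ∀ κ : ℂ, κ.re = 0 → ∀ n : ℕ, 1 + κ + n ≠ 0 := fun κ hκ n => by
    rw [add_comm 1 κ]; exact add_one_add_natCast_ne_zero hκ n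
  have hz : ‖(x : ℂ)‖ < 1 := by simpa [abs_of_pos hx0] using hx1
  have k0 : (s + ε + Complex.I * r) / 2 + (1 - s + ε + Complex.I * r) / 2 - (1 / 2 + ε)
      = Complex.I * r := by ring
  have k1 : (1 / 2 + ε : ℂ) - (s + ε + Complex.I * r) / 2 - (1 - s + ε + Complex.I * r) / 2
    = -(Complex.I * r) := by ring
  have k2 : (1 / 2 + ε : ℂ) - (s + ε + Complex.I * r) / 2 = (1 - s + ε - Complex.I * r) / 2 :=
      by ring
  have k3 : (1 / 2 + ε : ℂ) - (1 - s + ε + Complex.I * r) / 2 = (s + ε - Complex.I * r) / 2 :=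
      by ring
  have h := hypergeometric_connection hC (A := (s + ε + Complex.I * r) / 2)
    (B := (1 - s + ε + Complex.I * r) / 2) (by rw [k0]; simp) (by rw [k0]; simp [hr])
    (ofReal_mem_lens (w := 1 - x) (by linarith) (by linarith))
  have hx : (1 : ℂ) - ((1 - x : ℝ) : ℂ) = x := by push_cast; ring
  have hx' : ((1 - x : ℝ) : ℂ) = 1 - (x : ℂ) := by push_cast; ring
  have f1 : ₂F₁ ((s + ε + Complex.I * r) / 2) ((1 - s + ε + Complex.I * r) / 2) (1 + Complex.I * r)
      (x : ℂ)
      = ((1 - x : ℝ) : ℂ) ^ (-(ε : ℂ) / 2)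
        * ₂F₁ ((s + Complex.I * r) / 2) ((1 - s + Complex.I * r) / 2) (1 + Complex.I
          * r) (x : ℂ) := by
    rcases hε with rfl | rfl
    · simp
    · rw [euler_transformation (hI _ (by simp)) hz, ordinaryHypergeometric_comm, hx']
      congr 2 <;> push_cast <;> ring
  have f2 : ₂F₁ ((1 - s + ε - Complex.I * r) / 2) ((s + ε - Complex.I * r) / 2) (-(Complex.I * r)
      + 1) (x : ℂ)
      = ((1 - x : ℝ) : ℂ) ^ (-(ε : ℂ) / 2)
        * ₂F₁ ((s - Complex.I * r) / 2) ((1 - s - Complex.I * r) / 2) (1 - Complex.I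
          * r) (x : ℂ) := by
    rw [neg_add_eq_sub]
    rcases hε with rfl | rfl
    · simp [ordinaryHypergeometric_comm]
    · rw [sub_eq_add_neg 1 (Complex.I * (r : ℂ)), euler_transformation (hI _ (by simp)) hz, hx']
      congr 2 <;> push_cast <;> ring
  rw [h, k0, k1, k2, k3, hx, add_comm (Complex.I * (r : ℂ)) 1, f1, f2]
  ring

theorem norm_Gammaℝ (s : ℂ) : ‖Complex.Gammaℝ s‖ = Real.pi ^ (-s.re / 2)
    * ‖Complex.Gamma (s / 2)‖ := by
  rw [Complex.Gammaℝ_def, norm_mul, Complex.norm_cpow_eq_rpow_re_of_pos Real.pi_pos]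
  congr 2
  simp

theorem norm_Gamma_half_add {ε : ℕ} (hε : ε = 0 ∨ ε = 1) :
    ‖Complex.Gamma (1 / 2 + ε)‖ = Real.pi ^ (1 / 2 : ℝ) * 2 ^ (-(ε : ℝ)) := by
  have h : ‖Complex.Gamma (1 / 2)‖ = Real.pi ^ (1 / 2 : ℝ) := by
    rw [Complex.Gamma_one_half_eq]
    have : (1 / 2 : ℂ) = ((1 / 2 : ℝ) : ℂ) := by push_cast; rfl
    rw [this, Complex.norm_cpow_real, Complex.norm_real, Real.norm_of_nonneg Real.pi_pos.le]
  rcases hε with rfl | rfl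
  · simpa using h
  · rw [add_comm, Nat.cast_one, add_comm, Complex.Gamma_add_one _ (by norm_num), norm_mul, h]
    norm_num
    ring

/-- The quotient of Gamma factors in the coefficients of the connection formula; the base is
`6 = (5 / 2) ^ 2 - 1 / 4`. -/
theorem rpow_mul_norm_Gamma_half_le {σ e y : ℝ} (he : 0 ≤ e) (hσ : 1 / 2 ≤ σ) (hσ1 : σ ≤ 1)
    (hy : 25 ≤ y ^ 2) :
    (6 : ℝ) ^ ((σ - 1 / 2) / 2) * ‖Complex.Gamma ((1 - σ + e - Complex.I * y) / 2)‖
      ≤ ‖Complex.Gamma ((σ + e + Complex.I * y) / 2)‖ := by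
  have h := rpow_mul_norm_Gamma_le (v := (1 - σ + e) / 2) (q := σ - 1 / 2) (y := y / 2)
      (by linarith)
    (by linarith) (by linarith) (by nlinarith)
  have c1 : ((1 - σ + e - Complex.I * y) / 2 : ℂ)
      = (starRingEnd ℂ) (((1 - σ + e) / 2 : ℝ) + (y / 2 : ℝ) * Complex.I) := by
    rw [map_add, map_mul, Complex.conj_ofReal, Complex.conj_ofReal, Complex.conj_I]
    push_cast
    ring
  have c2 : ((σ + e + Complex.I * y) / 2 : ℂ)
      = (((1 - σ + e) / 2 + (σ - 1 / 2) : ℝ) : ℂ) + (y / 2 : ℝ) * Complex.I := by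
    push_cast; ring
  rw [c1, c2, Complex.Gamma_conj, RCLike.norm_conj]
  refine le_of_sq_le_sq ?_ (norm_nonneg _)
  refine le_trans ?_ h
  rw [mul_pow, ← Real.rpow_natCast, ← Real.rpow_mul (by norm_num)]
  have : (σ - 1 / 2) / 2 * ((2 : ℕ) : ℝ) = σ - 1 / 2 := by push_cast; ring
  rw [this]
  gcongr
  linarith

theorem seven_eighths_le_rpow {q : ℝ} (hq1 : q ≤ 1 / 2) : 7 / 8 ≤ (6 : ℝ) ^ (q / 2)
    * Real.pi ^ (-q) := by
  have e : (6 : ℝ) ^ (q / 2) * Real.pi ^ (-q) = (√6 / Real.pi) ^ q := by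
    rw [Real.div_rpow (Real.sqrt_nonneg _) Real.pi_pos.le, Real.rpow_neg Real.pi_pos.le,
        Real.sqrt_eq_rpow,
      ← Real.rpow_mul (by norm_num), div_eq_mul_inv]
    congr 2
    ring
  have h6 : (2.449 : ℝ) ≤ √6 := Real.le_sqrt_of_sq_le (by norm_num)
  have h6' : √6 ≤ 2.45 := Real.sqrt_le_iff.2 (by norm_num)
  have hpi := Real.pi_lt_d4
  have hpi' := Real.pi_gt_three
  have h1 : (49 / 64 : ℝ) ≤ √6 / Real.pi := by
    rw [le_div_iff₀ Real.pi_pos]; linarith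
  have h2 : √6 / Real.pi ≤ 1 := by
    rw [div_le_one Real.pi_pos]; linarith
  rw [e]
  calc (7 / 8 : ℝ) = √(49 / 64) := by
        rw [show (49 / 64 : ℝ) = (7 / 8) ^ 2 by norm_num, Real.sqrt_sq (by norm_num)]
    _ ≤ √(√6 / Real.pi) := Real.sqrt_le_sqrt h1
    _ = (√6 / Real.pi) ^ (1 / 2 : ℝ) := Real.sqrt_eq_rpow _
    _ ≤ _ := Real.rpow_le_rpow_of_exponent_ge (by linarith) h2 hq1

theorem Gamma_ne_zero_of_im_ne_zero {z : ℂ} (hz : z.im ≠ 0) : Complex.Gamma z ≠ 0 :=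
  Complex.Gamma_ne_zero fun m hm => hz (by simp [hm])

/-- The larger of the two connection coefficients, multiplied by the archimedean factors. One of
`|t + r|` and `|t - r|` is at least `r`. -/
theorem le_Gammaℝ_mul_connection_coeff {ε : ℕ} (hε : ε = 0 ∨ ε = 1) {r σ t : ℝ} (hr : 5 < r)
    (hσ : 1 / 2 ≤ σ)
    (hσ1 : σ ≤ 1) {s : ℂ} (hs : s = σ + Complex.I * t) {α β : ℂ}
    (hα : α = Complex.Gamma (1 / 2 + ε) * Complex.Gamma (-(Complex.I * r))
      / (Complex.Gamma ((1 - s + ε - Complex.I * r) / 2) * Complex.Gamma ((s + ε - Complex.I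
          * r) / 2)))
    (hβ : β = Complex.Gamma (1 / 2 + ε) * Complex.Gamma (Complex.I * r)
      / (Complex.Gamma ((s + ε + Complex.I * r) / 2) * Complex.Gamma ((1 - s + ε + Complex.I
          * r) / 2))) :
    7 / 8 * (2 * Real.pi) ^ (-(ε : ℝ)) * ‖Complex.Gamma (Complex.I * r)‖
      ≤ ‖Complex.Gammaℝ (s + ε + Complex.I * r)‖ * ‖Complex.Gammaℝ (s + ε - Complex.I * r)‖
        * √(‖α‖ ^ 2 + ‖β‖ ^ 2) := by
  have hε0 : (0 : ℝ) ≤ ε := ε.cast_nonneg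
  set Γa := ‖Complex.Gamma ((s + ε + Complex.I * r) / 2)‖ with hΓa
  set Γb := ‖Complex.Gamma ((s + ε - Complex.I * r) / 2)‖ with hΓb
  have ha : 0 < Γa := norm_pos_iff.2 (Complex.Gamma_ne_zero_of_re_pos (by simp [hs]; linarith))
  have hb : 0 < Γb := norm_pos_iff.2 (Complex.Gamma_ne_zero_of_re_pos (by simp [hs]; linarith))
  have ng : ‖Complex.Gamma (-(Complex.I * r))‖ = ‖Complex.Gamma (Complex.I * r)‖ := by
    have : -(Complex.I * r) = (starRingEnd ℂ) (Complex.I * r) := by simp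
    rw [this, Complex.Gamma_conj, RCLike.norm_conj]
  have hG : ‖Complex.Gammaℝ (s + ε + Complex.I * r)‖ * ‖Complex.Gammaℝ (s + ε - Complex.I * r)‖
      = Real.pi ^ (-(σ + ε)) * (Γa * Γb) := by
    rw [norm_Gammaℝ, norm_Gammaℝ]
    have e1 : (s + ε + Complex.I * r).re = σ + ε := by simp [hs]
    have e2 : (s + ε - Complex.I * r).re = σ + ε := by simp [hs]
    have e3 : Real.pi ^ (-(σ + ε)) = Real.pi ^ (-(σ + ε) / 2) * Real.pi ^ (-(σ + ε) / 2) := by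
      rw [← Real.rpow_add Real.pi_pos, add_halves]
    rw [e1, e2, e3, mul_mul_mul_comm]
  -- the two cases below reduce to this inequality
  have key : ∀ {g h : ℝ} {γ : ℂ}, 0 < h → (6 : ℝ) ^ ((σ - 1 / 2) / 2) * h ≤ g →
      Γa * Γb * ‖γ‖ = ‖Complex.Gamma (1 / 2 + ε)‖ * ‖Complex.Gamma (Complex.I * r)‖ * (g / h) →
      ‖γ‖ ≤ √(‖α‖ ^ 2 + ‖β‖ ^ 2) →
      7 / 8 * (2 * Real.pi) ^ (-(ε : ℝ)) * ‖Complex.Gamma (Complex.I * r)‖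
      ≤ ‖Complex.Gammaℝ (s + ε + Complex.I * r)‖ * ‖Complex.Gammaℝ (s + ε - Complex.I * r)‖
        * √(‖α‖ ^ 2 + ‖β‖ ^ 2) := by
    intro g h γ hh hgh hγ hle
    have q78 := seven_eighths_le_rpow (q := σ - 1 / 2) (by linarith)
    have hdiv : (6 : ℝ) ^ ((σ - 1 / 2) / 2) ≤ g / h := (le_div_iff₀ hh).2 hgh
    have epi : (2 * Real.pi) ^ (-(ε : ℝ)) * Real.pi ^ (-(σ - 1 / 2))
        = Real.pi ^ (-(σ + ε)) * (Real.pi ^ (1 / 2 : ℝ) * 2 ^ (-(ε : ℝ))) := by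
      rw [Real.mul_rpow (by norm_num) Real.pi_pos.le, mul_assoc, ← Real.rpow_add Real.pi_pos,
          ← mul_assoc,
        ← Real.rpow_add Real.pi_pos, mul_comm]
      congr 2
      ring
    rw [hG]
    calc 7 / 8 * (2 * Real.pi) ^ (-(ε : ℝ)) * ‖Complex.Gamma (Complex.I * r)‖
        ≤ ((6 : ℝ) ^ ((σ - 1 / 2) / 2) * Real.pi ^ (-(σ - 1 / 2))) * (2 * Real.pi) ^ (-(ε : ℝ))
          * ‖Complex.Gamma (Complex.I * r)‖ := by gcongr
      _ = ((2 * Real.pi) ^ (-(ε : ℝ)) * Real.pi ^ (-(σ - 1 / 2))) * ‖Complex.Gamma (Complex.I * r)‖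
          * (6 : ℝ) ^ ((σ - 1 / 2) / 2) := by ring
      _ ≤ ((2 * Real.pi) ^ (-(ε : ℝ)) * Real.pi ^ (-(σ - 1 / 2))) * ‖Complex.Gamma (Complex.I * r)‖
          * (g / h) := by gcongr
      _ = Real.pi ^ (-(σ + ε)) * (Γa * Γb * ‖γ‖) := by
        rw [hγ, epi, norm_Gamma_half_add hε]; ring
      _ = Real.pi ^ (-(σ + ε)) * (Γa * Γb) * ‖γ‖ := by ring
      _ ≤ _ := by gcongr
  rcases le_total 0 t with ht | ht
  · have hA : (1 - s + ε - Complex.I * r) / 2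
        = (1 - σ + (ε : ℝ) - Complex.I * (t + r : ℝ)) / 2 := by
      rw [hs]; push_cast; ring
    have hA' : (s + ε + Complex.I * r) / 2 = (σ + (ε : ℝ) + Complex.I * (t + r : ℝ)) / 2 := by
      rw [hs]; push_cast; ring
    have hg := rpow_mul_norm_Gamma_half_le (σ := σ) (e := ε) (y := t + r) hε0 hσ hσ1 (by nlinarith)
    rw [← hA, ← hA', ← hΓa] at hg
    have hne : 0 < ‖Complex.Gamma ((1 - s + ε - Complex.I * r) / 2)‖ := by
      refine norm_pos_iff.2 (Gamma_ne_zero_of_im_ne_zero ?_)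
      rw [hA]
      simp
      linarith
    refine key (γ := α) hne hg ?_ (Real.le_sqrt_of_sq_le (by nlinarith [norm_nonneg β]))
    rw [hα, norm_div, norm_mul, norm_mul, ng, ← hΓb]
    field_simp
  · have hA : (1 - s + ε + Complex.I * r) / 2
        = (1 - σ + (ε : ℝ) - Complex.I * (t - r : ℝ)) / 2 := by
      rw [hs]; push_cast; ring
    have hA' : (s + ε - Complex.I * r) / 2 = (σ + (ε : ℝ) + Complex.I * (t - r : ℝ)) / 2 := by
      rw [hs]; push_cast; ring
    have hg := rpow_mul_norm_Gamma_half_le (σ := σ) (e := ε) (y := t - r) hε0 hσ hσ1 (by nlinarith)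
    rw [← hA, ← hA', ← hΓb] at hg
    have hne : 0 < ‖Complex.Gamma ((1 - s + ε + Complex.I * r) / 2)‖ := by
      refine norm_pos_iff.2 (Gamma_ne_zero_of_im_ne_zero ?_)
      rw [hA]
      simp
      linarith
    refine key (γ := β) hne hg ?_ (Real.le_sqrt_of_sq_le (by nlinarith [norm_nonneg α]))
    rw [hβ, norm_div, norm_mul, norm_mul, ← hΓa]
    field_simp

theorem le_norm_twistedGamma {N : ℕ} (hN : 1 ≤ N) {w : ℂ} (hw : ‖w‖ = 1) (ε : ℕ) (r : ℝ) {θ c T : ℝ}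
    (hc : 0 ≤ c) (hθ : 0 < Real.cos θ) (hcθ : c ≤ Real.cos θ) {s : ℂ} (hs : 1 / 2 ≤ s.re)
    (hT : T ≤ ‖₂F₁ ((s + ε + Complex.I * r) / 2) ((1 - s + ε + Complex.I * r) / 2)
        (1 / 2 + ε) ((1 - Real.cos θ ^ 2 : ℝ) : ℂ)‖) :
    c ^ (1 / 2 + ε : ℝ) * (‖Complex.Gammaℝ (s + ε + Complex.I * r)‖ * ‖Complex.Gammaℝ (s
        + ε - Complex.I * r)‖ * T)
      ≤ ‖twistedGamma N w ε r θ s‖ := by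
  rw [norm_twistedGamma hN hw ε r hθ s]
  have hN' : (1 : ℝ) ≤ √N := by
    rw [Real.one_le_sqrt]; exact_mod_cast hN
  set F := ‖₂F₁ ((s + ε + Complex.I * r) / 2) ((1 - s + ε + Complex.I * r) / 2)
        (1 / 2 + ε) ((1 - Real.cos θ ^ 2 : ℝ) : ℂ)‖
  set G₁ := ‖Complex.Gammaℝ (s + ε + Complex.I * r)‖
  set G₂ := ‖Complex.Gammaℝ (s + ε - Complex.I * r)‖
  have h1 : Real.cos θ ^ (1 / 2 - s.re) ≤ (Real.cos θ / √N) ^ (1 / 2 - s.re) := by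
    refine Real.rpow_le_rpow_of_nonpos (by positivity) ?_ (by linarith)
    exact div_le_self hθ.le hN'
  have h2 : Real.cos θ ^ (1 / 2 - s.re) * Real.cos θ ^ (s.re + ε)
      = Real.cos θ ^ (1 / 2 + ε : ℝ) := by
    rw [← Real.rpow_add hθ]; congr 1; ring
  calc c ^ (1 / 2 + ε : ℝ) * (G₁ * G₂ * T) ≤ c ^ (1 / 2 + ε : ℝ) * (G₁ * G₂ * F) := by gcongr
    _ ≤ Real.cos θ ^ (1 / 2 + ε : ℝ) * (G₁ * G₂ * F) := by gcongr
    _ = Real.cos θ ^ (1 / 2 - s.re) * G₁ * G₂ * (Real.cos θ ^ (s.re + ε) * F) := by rw [← h2]; ring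
    _ ≤ _ := by gcongr

theorem two_thirds_le_max_norm_twistedGamma {N : ℕ} (hN : 1 ≤ N) {w : ℂ} (hw : ‖w‖ = 1) {ε : ℕ}
    (hε : ε = 0 ∨ ε = 1) {r : ℝ} (hr : 5 < r) {θ₁ θ₂ : ℝ} (h1 : 0 < Real.cos θ₁)
    (hcos : Real.cos θ₂ = Real.exp (-(Real.pi / (2 * r))) * Real.cos θ₁) {σ t : ℝ} (hσ : 1 / 2 ≤ σ)
    (hσ1 : σ ≤ 1) (hx : Real.cos θ₁ ^ 2 * (4 + |t ^ 2 - r ^ 2|) ≤ 1) :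
    2 / 3 * Real.cos θ₂ ^ ((1 / 2 : ℝ) + ε) * (2 * Real.pi) ^ (-(ε : ℝ))
          * (Real.pi / (r * Real.sinh (Real.pi * r))) ^ (1 / 2 : ℝ)
        ≤ max ‖twistedGamma N w ε r θ₁ ((σ : ℂ) + Complex.I * t)‖
            ‖twistedGamma N w ε r θ₂ ((σ : ℂ) + Complex.I * t)‖ := by
  have hr0 : 0 < r := by linarith
  have h2 : 0 < Real.cos θ₂ := by rw [hcos]; positivity
  have h21 : Real.cos θ₂ ≤ Real.cos θ₁ := by
    rw [hcos]
    have : 0 ≤ Real.pi / (2 * r) := by positivity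
    exact mul_le_of_le_one_left h1.le (Real.exp_le_one_iff.2 (by linarith))
  set D := |t ^ 2 - r ^ 2| with hD
  have hD0 : 0 ≤ D := abs_nonneg _
  set s : ℂ := (σ : ℂ) + Complex.I * t with hs
  have hsre : s.re = σ := by simp [hs]
  set x₁ := Real.cos θ₁ ^ 2 with hx₁
  set x₂ := Real.cos θ₂ ^ 2 with hx₂
  have p1 : 0 < x₁ := by positivity
  have p2 : 0 < x₂ := by positivity
  have x21 : x₂ ≤ x₁ := by rw [hx₁, hx₂]; gcongr
  have hxx : x₂ * (4 + D) ≤ 1 := by nlinarith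
  have l1 : x₁ < 1 := by nlinarith
  have l2 : x₂ < 1 := by linarith
  have ex : x₂ = Real.exp (-(Real.pi / r)) * x₁ := by
    rw [hx₁, hx₂, hcos, mul_pow, ← Real.exp_nat_mul]
    congr 2
    push_cast
    field_simp
  -- the phases at the two points are opposite
  have phase : (x₂ : ℂ) ^ (-(Complex.I * r)) = -(x₁ : ℂ) ^ (-(Complex.I * r)) := by
    have c1 : (x₁ : ℂ) ≠ 0 := by exact_mod_cast p1.ne'
    have c2 : (x₂ : ℂ) ≠ 0 := by exact_mod_cast p2.ne'
    have hl : Real.log x₂ = -(Real.pi / r) + Real.log x₁ := by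
      rw [ex, Real.log_mul (Real.exp_pos _).ne' p1.ne', Real.log_exp]
    rw [Complex.cpow_def_of_ne_zero c1, Complex.cpow_def_of_ne_zero c2, ← Complex.ofReal_log p1.le,
      ← Complex.ofReal_log p2.le, hl]
    have : ((-(Real.pi / r) + Real.log x₁ : ℝ) : ℂ) * -(Complex.I * r)
        = (Real.log x₁ : ℂ) * -(Complex.I * r) + Real.pi * Complex.I := by
      have : (r : ℂ) ≠ 0 := by exact_mod_cast hr0.ne'
      push_cast
      field_simp
      ring
    rw [this, Complex.exp_add, Complex.exp_pi_mul_I]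
    ring
  have nphase : ‖(x₁ : ℂ) ^ (-(Complex.I * r))‖ = 1 := by
    rw [Complex.norm_cpow_eq_rpow_re_of_pos p1]; simp
  obtain ⟨α, hα⟩ : ∃ α, α = Complex.Gamma (1 / 2 + ε) * Complex.Gamma (-(Complex.I * r))
      / (Complex.Gamma ((1 - s + ε - Complex.I * r) / 2) * Complex.Gamma ((s + ε - Complex.I
          * r) / 2)) := ⟨_, rfl⟩
  obtain ⟨β, hβ⟩ : ∃ β, β = Complex.Gamma (1 / 2 + ε) * Complex.Gamma (Complex.I * r)
      / (Complex.Gamma ((s + ε + Complex.I * r) / 2) * Complex.Gamma ((1 - s + ε + Complex.I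
          * r) / 2)) := ⟨_, rfl⟩
  have main := le_Gammaℝ_mul_connection_coeff hε hr hσ hσ1 hs hα hβ
  have hrabs : 5 ≤ |r| := by rw [abs_of_pos hr0]; exact hr.le
  have U : ∀ x : ℝ, 0 ≤ x → x * (4 + D) ≤ 1 → ‖₂F₁ ((s + Complex.I * r) / 2) ((1 - s + Complex.I
      * r) / 2)
      (1 + Complex.I * r) (x : ℂ) - 1‖ ≤ 1 / 6 := fun x h0 hx =>
    norm_hypergeometric_sub_one_le hσ hσ1 hrabs h0 hx
  have V : ∀ x : ℝ, 0 ≤ x → x * (4 + D) ≤ 1 → ‖₂F₁ ((s - Complex.I * r) / 2) ((1 - s - Complex.I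
      * r) / 2)
      (1 - Complex.I * r) (x : ℂ) - 1‖ ≤ 1 / 6 := fun x h0 hx => by
    have := norm_hypergeometric_sub_one_le (r := -r) (t := t)
      hσ hσ1 (by rwa [abs_neg]) h0 (by rwa [neg_sq])
    simpa only [Complex.ofReal_neg, mul_neg, ← sub_eq_add_neg] using this
  have drop : ∀ {x : ℝ}, 0 < x → x < 1 → ∀ Z : ℂ, ‖Z‖
      ≤ ‖((1 - x : ℝ) : ℂ) ^ (-(ε : ℂ) / 2) * Z‖ := by
    intro x hx0 hx1 Z
    rw [norm_mul, Complex.norm_cpow_eq_rpow_re_of_pos (by linarith)]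
    refine le_mul_of_one_le_left (norm_nonneg _) ?_
    refine Real.one_le_rpow_of_pos_of_le_one_of_nonpos (by linarith) (by linarith) ?_
    have : (-(ε : ℂ) / 2).re = -(ε : ℝ) / 2 := by simp
    rw [this]
    linarith [ε.cast_nonneg (α := ℝ)]
  have F1 := twisted_connection hε hr0.ne' s p1 l1
  have F2 := twisted_connection hε hr0.ne' s p2 l2
  rw [← hα, ← hβ] at F1 F2
  have D1 := drop p1 l1 (α * ₂F₁ ((s + Complex.I * r) / 2) ((1 - s + Complex.I * r) / 2) (1
      + Complex.I * r) (x₁ : ℂ)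
    + β * (x₁ : ℂ) ^ (-(Complex.I * r))
      * ₂F₁ ((s - Complex.I * r) / 2) ((1 - s - Complex.I * r) / 2) (1 - Complex.I * r) (x₁ : ℂ))
  have D2 := drop p2 l2 (α * ₂F₁ ((s + Complex.I * r) / 2) ((1 - s + Complex.I * r) / 2) (1
      + Complex.I * r) (x₂ : ℂ)
    + β * (x₂ : ℂ) ^ (-(Complex.I * r))
      * ₂F₁ ((s - Complex.I * r) / 2) ((1 - s - Complex.I * r) / 2) (1 - Complex.I * r) (x₂ : ℂ))
  rw [← F1] at D1
  rw [← F2, phase, mul_neg, neg_mul, ← sub_eq_add_neg] at D2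
  have par := le_max_norm_add_norm_sub (α := α) (β := β * (x₁ : ℂ) ^ (-(Complex.I * r)))
    (U x₁ p1.le hx) (U x₂ p2.le hxx) (V x₁ p1.le hx) (V x₂ p2.le hxx)
  rw [norm_mul β, nphase, mul_one] at par
  set S := √(‖α‖ ^ 2 + ‖β‖ ^ 2) with hS
  have num : (2 / 3 : ℝ) ≤ (1 - √2 / 6) * (7 / 8) := by
    have : √2 ≤ 1.4143 := Real.sqrt_le_iff.2 (by norm_num)
    linarith
  have hΓ : (Real.pi / (r * Real.sinh (Real.pi * r))) ^ (1 / 2 : ℝ) = ‖Complex.Gamma (Complex.I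
      * r)‖ := by
    rw [← norm_sq_Gamma_I_mul hr0, ← Real.sqrt_eq_rpow, Real.sqrt_sq (norm_nonneg _)]
  have h0 : 0 ≤ 1 - √2 / 6 := by linarith
  have bound : 2 / 3 * Real.cos θ₂ ^ ((1 / 2 : ℝ) + ε) * (2 * Real.pi) ^ (-(ε : ℝ))
          * (Real.pi / (r * Real.sinh (Real.pi * r))) ^ (1 / 2 : ℝ)
      ≤ Real.cos θ₂ ^ ((1 / 2 : ℝ) + ε) * (‖Complex.Gammaℝ (s + ε + Complex.I * r)‖
        * ‖Complex.Gammaℝ (s + ε - Complex.I * r)‖ * ((1 - √2 / 6) * S)) := by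
    rw [hΓ]
    calc _ = Real.cos θ₂ ^ ((1 / 2 : ℝ) + ε) * (2 / 3 * ((2 * Real.pi) ^ (-(ε : ℝ))
            * ‖Complex.Gamma (Complex.I * r)‖)) := by ring
      _ ≤ Real.cos θ₂ ^ ((1 / 2 : ℝ) + ε) * ((1 - √2 / 6) * (7 / 8) * ((2 * Real.pi) ^ (-(ε : ℝ))
            * ‖Complex.Gamma (Complex.I * r)‖)) := by gcongr
      _ = Real.cos θ₂ ^ ((1 / 2 : ℝ) + ε) * ((1 - √2 / 6) * (7 / 8 * (2 * Real.pi) ^ (-(ε : ℝ))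
            * ‖Complex.Gamma (Complex.I * r)‖)) := by ring
      _ ≤ Real.cos θ₂ ^ ((1 / 2 : ℝ) + ε) * ((1 - √2 / 6) * (‖Complex.Gammaℝ (s + ε + Complex.I
          * r)‖
        * ‖Complex.Gammaℝ (s + ε - Complex.I * r)‖ * S)) := by gcongr
      _ = _ := by ring
  rcases le_max_iff.1 par with h | h
  · exact le_max_of_le_left (bound.trans
      (le_norm_twistedGamma hN hw ε r h2.le h1 h21 (by rw [hsre]; exact hσ) (h.trans D1)))
  · exact le_max_of_le_right (bound.trans
      (le_norm_twistedGamma hN hw ε r h2.le h2 le_rfl (by rw [hsre]; exact hσ) (h.trans D2)))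

/-! ### Sturm comparison -/

/-- Maximum principle behind Sturm's comparison theorem: if `φ > 0` satisfies `φ'' = -P φ` and `u`
satisfies `u'' = -Q u` with `Q < P`, then `u / φ` has no positive interior maximum. -/
theorem sturm_nonpos {a b : ℝ} {u u' φ φ' P Q : ℝ → ℝ}
    (hu : ∀ x ∈ Icc a b, HasDerivAt u (u' x) x) (hu' : ∀ x ∈ Icc a b, HasDerivAt u' (-Q x * u x) x)
    (hφ : ∀ x ∈ Icc a b, HasDerivAt φ (φ' x) x) (hφ' : ∀ x ∈ Icc a b, HasDerivAt φ' (-P x * φ x) x)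
    (hpos : ∀ x ∈ Icc a b, 0 < φ x) (hPQ : ∀ x ∈ Icc a b, Q x < P x) (ha : u a = 0) (hb : u b = 0)
    {x : ℝ} (hx : x ∈ Icc a b) : u x ≤ 0 := by
  by_contra! hux
  have hdv : ∀ y ∈ Icc a b, HasDerivAt (fun y => u y / φ y) ((u' y * φ y - u y
      * φ' y) / φ y ^ 2) y :=
    fun y hy => (hu y hy).div (hφ y hy) (hpos y hy).ne'
  obtain ⟨m, hm, hmax⟩ := isCompact_Icc.exists_isMaxOn ⟨x, hx⟩
    (f := fun y => u y / φ y) fun y hy => (hdv y hy).continuousAt.continuousWithinAt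
  have hvm : 0 < u m / φ m := lt_of_lt_of_le (div_pos hux (hpos x hx)) (hmax hx)
  have hum : 0 < u m := by
    have := mul_pos hvm (hpos m hm)
    rwa [div_mul_cancel₀ _ (hpos m hm).ne'] at this
  have hma : m ≠ a := fun h => by rw [h, ha] at hum; exact lt_irrefl _ hum
  have hmb : m ≠ b := fun h => by rw [h, hb] at hum; exact lt_irrefl _ hum
  have ham : a < m := lt_of_le_of_ne hm.1 hma.symm
  have hmb' : m < b := lt_of_le_of_ne hm.2 hmb
  -- the Wronskian `W` vanishes at the maximum and is strictly increasing there
  set W : ℝ → ℝ := fun y => u' y * φ y - u y * φ' y with hW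
  have hW0 : W m = 0 := by
    have hloc : IsLocalMax (fun y => u y / φ y) m := hmax.isLocalMax (Icc_mem_nhds ham hmb')
    have := hloc.hasDerivAt_eq_zero (hdv m hm)
    rw [div_eq_zero_iff] at this
    exact this.resolve_right (pow_ne_zero _ (hpos m hm).ne')
  have hWd : HasDerivAt W ((P m - Q m) * (u m * φ m)) m := by
    refine (((hu' m hm).mul (hφ m hm)).sub ((hu m hm).mul (hφ' m hm))).congr_deriv ?_
    ring
  have hWpos : ∀ᶠ y in 𝓝[>] m, 0 < W y := by
    have hpos' : 0 < (P m - Q m) * (u m * φ m) :=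
      mul_pos (sub_pos.2 (hPQ m hm)) (mul_pos hum (hpos m hm))
    have h := (hasDerivAt_iff_tendsto_slope.1 hWd).mono_left
      (nhdsWithin_mono m (fun y (hy : m < y) => (ne_of_gt hy : y ≠ m)))
    filter_upwards [h.eventually_const_lt hpos', self_mem_nhdsWithin] with y hy hym
    rw [slope_def_field, hW0, sub_zero] at hy
    exact (div_pos_iff_of_pos_right (sub_pos.2 hym)).1 hy
  obtain ⟨c, hc, hcW⟩ := (mem_nhdsGT_iff_exists_Ioo_subset' hmb').1 hWpos
  set d := min ((m + c) / 2) b with hd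
  have hmc : m < c := hc
  have hmd : m < d := lt_min (by linarith) hmb'
  have hdc : d < c := (min_le_left _ _).trans_lt (by linarith)
  have hdb : d ≤ b := min_le_right _ _
  have hsub : Icc m d ⊆ Icc a b := Icc_subset_Icc ham.le hdb
  have hmono : StrictMonoOn (fun y => u y / φ y) (Icc m d) := by
    refine strictMonoOn_of_deriv_pos (convex_Icc m d)
      (fun y hy => (hdv y (hsub hy)).continuousAt.continuousWithinAt) fun y hy => ?_
    rw [interior_Icc] at hy
    have hy' := hsub (Ioo_subset_Icc_self hy)
    rw [(hdv y hy').deriv]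
    exact div_pos (hcW ⟨hy.1, hy.2.trans hdc⟩) (pow_pos (hpos y hy') 2)
  exact absurd (hmax (hsub (right_mem_Icc.2 hmd.le)))
    (not_le.2 (hmono (left_mem_Icc.2 hmd.le) (right_mem_Icc.2 hmd.le) hmd))

theorem sturm_eq_zero {a b : ℝ} {u u' φ φ' P Q : ℝ → ℝ}
    (hu : ∀ x ∈ Icc a b, HasDerivAt u (u' x) x) (hu' : ∀ x ∈ Icc a b, HasDerivAt u' (-Q x * u x) x)
    (hφ : ∀ x ∈ Icc a b, HasDerivAt φ (φ' x) x) (hφ' : ∀ x ∈ Icc a b, HasDerivAt φ' (-P x * φ x) x)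
    (hpos : ∀ x ∈ Icc a b, 0 < φ x) (hPQ : ∀ x ∈ Icc a b, Q x < P x) (ha : u a = 0) (hb : u b = 0)
    {x : ℝ} (hx : x ∈ Icc a b) : u x = 0 := by
  refine le_antisymm (sturm_nonpos hu hu' hφ hφ' hpos hPQ ha hb hx) ?_
  have := sturm_nonpos (u := -u) (u' := -u') (Q := Q) (fun x hx => (hu x hx).neg)
    (fun x hx => (hu' x hx).neg.congr_deriv (by simp)) hφ hφ' hpos hPQ (by simp [ha])
        (by simp [hb]) hx
  simpa using this

/-- The comparison function `√(1 - w) cos (ρ (log (1 - w) - m))` solves `φ'' = -(1/4 + ρ²) (1 - w)⁻²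
φ`. -/
theorem hasDerivAt_comparison (ρ m : ℝ) {w : ℝ} (hw : w < 1) :
    HasDerivAt (fun w => Real.exp (Real.log (1 - w) / 2) * Real.cos (ρ * (Real.log (1 - w) - m)))
      (-(Real.exp (-(Real.log (1 - w) / 2)) * (Real.cos (ρ * (Real.log (1 - w) - m)) / 2
        - ρ * Real.sin (ρ * (Real.log (1 - w) - m))))) w ∧
    HasDerivAt (fun w => -(Real.exp (-(Real.log (1 - w) / 2)) * (Real.cos (ρ
        * (Real.log (1 - w) - m)) / 2
        - ρ * Real.sin (ρ * (Real.log (1 - w) - m)))))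
      (-((1 / 4 + ρ ^ 2) / (1 - w) ^ 2)
        * (Real.exp (Real.log (1 - w) / 2) * Real.cos (ρ * (Real.log (1 - w) - m)))) w := by
  have hx : 0 < 1 - w := by linarith
  have hL : HasDerivAt (fun w => Real.log (1 - w)) (-1 / (1 - w)) w :=
    ((hasDerivAt_id w).const_sub 1).log hx.ne'
  have hE := (hL.div_const 2).exp
  have hE' := (hL.div_const 2).neg.exp
  have hT : HasDerivAt (fun w => ρ * (Real.log (1 - w) - m)) (ρ * (-1 / (1 - w))) w :=
    (hL.sub_const m).const_mul ρ
  have hexp : Real.exp (Real.log (1 - w) / 2) = (1 - w) * Real.exp (-(Real.log (1 - w) / 2)) := by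
    nth_rewrite 2 [← Real.exp_log hx]
    rw [← Real.exp_add]
    congr 1
    ring
  constructor
  · refine (hE.mul hT.cos).congr_deriv ?_
    rw [hexp]
    field_simp
    ring
  · refine (hE'.mul ((hT.cos.div_const 2).sub (hT.sin.const_mul ρ))).neg.congr_deriv ?_
    simp only [Pi.neg_apply, Pi.sub_apply]
    rw [hexp]
    field_simp
    ring

/-! ### The normal form of the hypergeometric equation -/

/-- The factor `z ^ (C / 2) (1 - z) ^ ((A + B - C + 1) / 2)` removes the first derivative from the
hypergeometric equation. -/
theorem hasDerivAt_normalForm {A B C : ℂ} (hC : ∀ n : ℕ, C + n ≠ 0) {z : ℂ} (hz : z ∈ lens) :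
    HasDerivAt (fun z => z ^ (C / 2) * (1 - z) ^ ((A + B - C + 1) / 2) * ₂F₁ A B C z)
      (z ^ (C / 2) * (1 - z) ^ ((A + B - C + 1) / 2) *
        ((C / 2 / z - (A + B - C + 1) / 2 / (1 - z)) * ₂F₁ A B C z + deriv (₂F₁ A B C) z)) z ∧
    HasDerivAt (fun z => z ^ (C / 2) * (1 - z) ^ ((A + B - C + 1) / 2) *
        ((C / 2 / z - (A + B - C + 1) / 2 / (1 - z)) * ₂F₁ A B C z + deriv (₂F₁ A B C) z))
      (-((1 - (1 - C) ^ 2) / (4 * z ^ 2) + (1 - (A + B - C) ^ 2) / (4 * (1 - z) ^ 2)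
        + (1 - (1 - C) ^ 2 - (A + B - C) ^ 2 + (A - B) ^ 2) / (4 * z * (1 - z)))
        * (z ^ (C / 2) * (1 - z) ^ ((A + B - C + 1) / 2) * ₂F₁ A B C z)) z := by
  have hs := mem_slitPlane_of_mem_lens hz
  have hs1 := one_sub_mem_slitPlane_of_mem_lens hz
  have h0 := Complex.slitPlane_ne_zero hs
  have h1 := Complex.slitPlane_ne_zero hs1
  have dF := hasDerivAt_hypergeometric A B C (norm_lt_of_mem_lens hz)
  have dF' := hasDerivAt_deriv_hypergeometric A B C (norm_lt_of_mem_lens hz)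
  have ode := hypEq_hypergeometric (A := A) (B := B) hC (norm_lt_of_mem_lens hz)
  unfold HypEq at ode
  set K := (A + B - C + 1) / 2 with hK
  have dp : HasDerivAt (fun z : ℂ => z ^ (C / 2) * (1 - z) ^ K)
      (z ^ (C / 2) * (1 - z) ^ K * (C / 2 / z - K / (1 - z))) z := by
    have k1 := (hasDerivAt_id z).cpow_const (c := C / 2) hs
    have k2 := ((hasDerivAt_id z).const_sub 1).cpow_const (c := K) (by simpa using hs1)
    refine (k1.mul k2).congr_deriv ?_
    simp only [id]
    rw [Complex.cpow_sub _ _ h0, Complex.cpow_sub _ _ h1, Complex.cpow_one, Complex.cpow_one]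
    ring
  have dh : HasDerivAt (fun z : ℂ => C / 2 / z - K / (1 - z))
      (-(C / 2) / z ^ 2 - K / (1 - z) ^ 2) z := by
    have k1 := (hasDerivAt_const z (C / 2)).div (hasDerivAt_id z) h0
    have k2 := (hasDerivAt_const z K).div ((hasDerivAt_id z).const_sub 1) h1
    refine (k1.sub k2).congr_deriv ?_
    simp
  constructor
  · refine (dp.mul dF).congr_deriv ?_
    ring
  · refine (dp.mul ((dh.mul dF).add dF')).congr_deriv ?_
    simp only [Pi.add_apply, Pi.mul_apply]
    have e : deriv (deriv (₂F₁ A B C)) z = (A * B * ₂F₁ A B C z - (C - (A + B + 1) * z)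
        * deriv (₂F₁ A B C) z)
        / (z * (1 - z)) := by
      rw [eq_div_iff (mul_ne_zero h0 h1)]
      linear_combination ode
    rw [e, hK]
    generalize z ^ (C / 2) * (1 - z) ^ ((A + B - C + 1) / 2) = p
    field_simp
    ring

/-! ### Zeros on the critical line -/

/-- The function `₂F₁ A B C` of the twisted factor on the critical line does not vanish at two
points whose distances `x₁ ≤ 1 / 4` and `x₂ = exp (-π / r) x₁` to `1` are that close. Its normal
form has the real potential `Q`; its zeros are compared with those of `√x cos (ρ (log x - m))`, `ρ =
7 r / 10`, which are `π / ρ > π / r` apart in `log x`. -/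
theorem hypergeometric_no_common_zero {ε : ℕ} (hε : ε = 0 ∨ ε = 1) {r t : ℝ} (hr : 5 < r)
    {x₁ x₂ : ℝ}
    (h1 : 0 < x₁) (h14 : x₁ ≤ 1 / 4) (h2 : x₂ = Real.exp (-(Real.pi / r)) * x₁) {s : ℂ}
    (hs : s = 1 / 2 + Complex.I * t) {A B C : ℂ} (hA : A = (s + ε + Complex.I * r) / 2)
    (hB : B = (1 - s + ε + Complex.I * r) / 2) (hC : C = 1 / 2 + ε)
    (hz1 : ₂F₁ A B C ((1 - x₁ : ℝ) : ℂ) = 0) (hz2 : ₂F₁ A B C ((1 - x₂ : ℝ) : ℂ) = 0) : False := by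
  have hr0 : 0 < r := by linarith
  have hCn : ∀ n : ℕ, C + n ≠ 0 := hC ▸ half_add_natCast_add_natCast_ne_zero ε
  have hp2 : 0 < x₂ := by rw [h2]; positivity
  have hlt : x₂ < x₁ := by
    rw [h2]
    exact mul_lt_of_lt_one_left h1 (Real.exp_lt_one_iff.2 (by simp only [neg_lt_zero]; positivity))
  have hmem : ∀ w ∈ Icc (1 - x₁) (1 - x₂), 3 / 4 ≤ w ∧ 0 < 1 - w ∧ 1 - w ≤ 1 / 4 := fun w hw =>
    ⟨by linarith [hw.1], by linarith [hw.2], by linarith [hw.1]⟩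
  have hlens : ∀ w ∈ Icc (1 - x₁) (1 - x₂), (w : ℂ) ∈ lens := fun w hw => by
    obtain ⟨a1, a2, -⟩ := hmem w hw
    exact ofReal_mem_lens (by linarith) (by linarith)
  have hκ : A + B - C = Complex.I * r := by rw [hA, hB, hC]; ring
  have hν : A - B = Complex.I * t := by rw [hA, hB, hs]; ring
  have hC2 : (1 - C) ^ 2 = 1 / 4 := by
    rw [hC]; rcases hε with rfl | rfl <;> norm_num
  set q : ℂ → ℂ := fun z => z ^ (C / 2) * (1 - z) ^ ((A + B - C + 1) / 2) * ₂F₁ A B C z with hq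
  set q₁ : ℂ → ℂ := fun z => z ^ (C / 2) * (1 - z) ^ ((A + B - C + 1) / 2) *
        ((C / 2 / z - (A + B - C + 1) / 2 / (1 - z)) * ₂F₁ A B C z + deriv (₂F₁ A B C) z) with hq₁
  set Q : ℝ → ℝ := fun w => 3 / 4 / (4 * w ^ 2) + (1 + r ^ 2) / (4 * (1 - w) ^ 2)
    + (3 / 4 + r ^ 2 - t ^ 2) / (4 * w * (1 - w)) with hQ
  have dq : ∀ w ∈ Icc (1 - x₁) (1 - x₂), HasDerivAt q (q₁ w) (w : ℂ) := fun w hw =>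
    (hasDerivAt_normalForm hCn (hlens w hw)).1
  have dq₁ : ∀ w ∈ Icc (1 - x₁) (1 - x₂), HasDerivAt q₁ (-(Q w : ℂ) * q w) (w : ℂ) := fun w hw => by
    refine (hasDerivAt_normalForm hCn (hlens w hw)).2.congr_deriv ?_
    rw [hC2, hκ, hν, mul_pow, mul_pow, Complex.I_sq]
    simp only [hQ, hq]
    rw [hκ]
    push_cast
    ring
  -- the comparison function
  set ρ := 7 / 10 * r with hρ
  set m := Real.log x₁ - Real.pi / (2 * r) with hm
  have hcos : ∀ w ∈ Icc (1 - x₁) (1 - x₂),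
      0 < Real.exp (Real.log (1 - w) / 2) * Real.cos (ρ * (Real.log (1 - w) - m)) := by
    intro w hw
    obtain ⟨-, hw0, -⟩ := hmem w hw
    have l1 : Real.log (1 - w) ≤ Real.log x₁ := Real.log_le_log hw0 (by linarith [hw.1])
    have l2 : Real.log x₂ ≤ Real.log (1 - w) := Real.log_le_log hp2 (by linarith [hw.2])
    rw [h2, Real.log_mul (Real.exp_pos _).ne' h1.ne', Real.log_exp] at l2
    have e1 : ρ * (Real.pi / (2 * r)) = 7 / 20 * Real.pi := by rw [hρ]; field_simp; norm_num
    have e2 : Real.pi / r = 2 * (Real.pi / (2 * r)) := by field_simp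
    have hρ0 : 0 < ρ := by positivity
    have u1 : ρ * (Real.log (1 - w) - m) ≤ ρ * (Real.pi / (2 * r)) := by
      gcongr; rw [hm]; linarith
    have u2 : ρ * -(Real.pi / (2 * r)) ≤ ρ * (Real.log (1 - w) - m) := by
      gcongr; rw [hm]; linarith
    have := Real.pi_pos
    exact mul_pos (Real.exp_pos _) (Real.cos_pos_of_mem_Ioo ⟨by linarith, by linarith⟩)
  have hPQ : ∀ w ∈ Icc (1 - x₁) (1 - x₂), Q w < (1 / 4 + ρ ^ 2) / (1 - w) ^ 2 := by
    intro w hw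
    obtain ⟨a1, a2, a3⟩ := hmem w hw
    have hw0 : 0 < w := by linarith
    rw [lt_div_iff₀ (by positivity)]
    set y := (1 - w) / w with hy
    have hy0 : 0 ≤ y := by positivity
    have hy1 : y ≤ 1 / 3 := by rw [hy, div_le_iff₀ hw0]; linarith
    have e : Q w * (1 - w) ^ 2 = 3 / 16 * y ^ 2 + (1 + r ^ 2) / 4 + (3 / 4 + r ^ 2 - t ^ 2) / 4
        * y := by
      simp only [hQ, hy]
      field_simp
      ring
    rw [e, hρ]
    have b1 : y ^ 2 ≤ 1 / 9 := by nlinarith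
    have b2 : (3 / 4 + r ^ 2 - t ^ 2) / 4 * y ≤ (3 / 4 + r ^ 2) / 4 * (1 / 3) := by
      have : (3 / 4 + r ^ 2 - t ^ 2) / 4 * y ≤ (3 / 4 + r ^ 2) / 4 * y := by
        gcongr; linarith [sq_nonneg t]
      refine this.trans ?_
      gcongr
    nlinarith
  have hcpos : 1 - x₁ < 1 - x₂ := by linarith
  have hzero : ∀ w ∈ Icc (1 - x₁) (1 - x₂), ₂F₁ A B C (w : ℂ) = 0 := by
    intro w hw
    -- the real solution `Re (conj (q w) * q)` has the value `|q w| ^ 2` at `w`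
    set γ := (starRingEnd ℂ) (q w) with hγ
    have du : ∀ v ∈ Icc (1 - x₁) (1 - x₂),
        HasDerivAt (fun v : ℝ => (γ * q v).re) ((γ * q₁ v).re) v := fun v hv =>
      ((dq v hv).const_mul γ).real_of_complex
    have du₁ : ∀ v ∈ Icc (1 - x₁) (1 - x₂),
        HasDerivAt (fun v : ℝ => (γ * q₁ v).re) (-Q v * (γ * q v).re) v := fun v hv => by
      refine ((dq₁ v hv).const_mul γ).real_of_complex.congr_deriv ?_
      rw [← Complex.ofReal_neg, mul_left_comm, Complex.re_ofReal_mul]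
    have := sturm_eq_zero (P := fun w => (1 / 4 + ρ ^ 2) / (1 - w) ^ 2) du du₁
      (fun v hv => (hasDerivAt_comparison ρ m (by linarith [(hmem v hv).2.1])).1)
      (fun v hv => (hasDerivAt_comparison ρ m (by linarith [(hmem v hv).2.1])).2)
      hcos hPQ (by simp only [hq, hz1, mul_zero, Complex.zero_re])
      (by simp only [hq, hz2, mul_zero, Complex.zero_re]) hw
    rw [hγ, mul_comm, Complex.mul_conj, Complex.ofReal_re, Complex.normSq_eq_zero] at this
    have c0 := Complex.slitPlane_ne_zero (mem_slitPlane_of_mem_lens (hlens w hw))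
    have c1 := Complex.slitPlane_ne_zero (one_sub_mem_slitPlane_of_mem_lens (hlens w hw))
    simp only [hq, mul_eq_zero, Complex.cpow_eq_zero_iff, c0, c1, false_and, false_or] at this
    exact this
  have hev : ∀ᶠ w : ℝ in 𝓝[>] (1 - x₁), ₂F₁ A B C (w : ℂ) = 0 := by
    filter_upwards [Ioo_mem_nhdsGT hcpos] with w hw
    exact hzero w (Ioo_subset_Icc_self hw)
  have htend : Tendsto (fun w : ℝ => (w : ℂ)) (𝓝[>] (1 - x₁)) (𝓝[≠] ((1 - x₁ : ℝ) : ℂ)) := by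
    refine tendsto_nhdsWithin_of_tendsto_nhds_of_eventually_within _
      (Complex.continuous_ofReal.continuousAt.tendsto.mono_left nhdsWithin_le_nhds) ?_
    filter_upwards [self_mem_nhdsWithin] with w hw
    exact fun h => (ne_of_gt hw) (Complex.ofReal_injective h)
  have hfr : ∃ᶠ z in 𝓝[≠] ((1 - x₁ : ℝ) : ℂ), ₂F₁ A B C z = 0 := htend.frequently hev.frequently
  have hid := (analyticOnNhd_hypergeometric A B C).eqOn_zero_of_preconnected_of_frequently_eq_zero
    (convex_ball (0 : ℂ) 1).isPreconnected (hlens _ (left_mem_Icc.2 hcpos.le)).1 hfr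
  have := hid (Metric.mem_ball_self one_pos)
  simp at this

theorem hypergeometric_eq_zero_of_twistedGamma_eq_zero {N : ℕ} (hN : 1 ≤ N) {w : ℂ} (hw : ‖w‖ = 1)
    {ε : ℕ}
    {r θ : ℝ} (hθ : 0 < Real.cos θ) {s : ℂ} (hs : 0 < s.re) (h : twistedGamma N w ε r θ s = 0) :
    ₂F₁ ((s + ε + Complex.I * r) / 2) ((1 - s + ε + Complex.I * r) / 2) (1 / 2 + ε)
      ((1 - Real.cos θ ^ 2 : ℝ) : ℂ) = 0 := by
  have hN' : (0 : ℝ) < N := by exact_mod_cast hN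
  have hε := ε.cast_nonneg (α := ℝ)
  have h' := norm_twistedGamma hN hw ε r hθ s
  rw [h, norm_zero] at h'
  have g1 : Complex.Gammaℝ (s + ε + Complex.I * r) ≠ 0 :=
    Complex.Gammaℝ_ne_zero_of_re_pos (by simp; linarith)
  have g2 : Complex.Gammaℝ (s + ε - Complex.I * r) ≠ 0 :=
    Complex.Gammaℝ_ne_zero_of_re_pos (by simp; linarith)
  have c1 : (Real.cos θ / √N) ^ (1 / 2 - s.re) ≠ 0 := by positivity
  have c2 : Real.cos θ ^ (s.re + ε) ≠ 0 := by positivity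
  have := h'.symm
  rw [mul_eq_zero, mul_eq_zero, mul_eq_zero, mul_eq_zero, norm_eq_zero, norm_eq_zero,
      norm_eq_zero] at this
  tauto

theorem sq_mul_le_one_of_le_rpow {c D : ℝ} (hc : 0 ≤ c) (hD : 0 ≤ D) (h : c ≤ (4
    + D) ^ (-(1 / 2) : ℝ)) :
    c ^ 2 * (4 + D) ≤ 1 := by
  have hD' : 0 < 4 + D := by linarith
  calc c ^ 2 * (4 + D) ≤ ((4 + D) ^ (-(1 / 2) : ℝ)) ^ 2 * (4 + D) := by gcongr
    _ = 1 := by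
      rw [← Real.rpow_natCast, ← Real.rpow_mul hD'.le]
      norm_num
      rw [Real.rpow_neg_one, inv_mul_cancel₀ hD'.ne']

theorem mainTheorem2 (N : ℕ) (hN : 1 ≤ N) (w : ℂ) (hw : ‖w‖ = 1) (ε : ℕ) (hε : ε = 0 ∨ ε = 1)
    (r : ℝ) (hr : 5 < r) (θ₁ θ₂ : ℝ) (hθ₁ : 0 < θ₁) (hθ₁₂ : θ₁ < θ₂) (hθ₂ : θ₂ < Real.pi / 2)
    (hcos : Real.cos θ₂ = Real.exp (-(Real.pi / (2 * r))) * Real.cos θ₁) :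
    (∀ σ t : ℝ, 1 / 2 ≤ σ → σ ≤ 1 →
      Real.cos θ₁ ≤ (4 + |t ^ 2 - r ^ 2|) ^ (-(1 / 2) : ℝ) →
      2 / 3 * Real.cos θ₂ ^ ((1 / 2 : ℝ) + ε) * (2 * Real.pi) ^ (-(ε : ℝ))
          * (Real.pi / (r * Real.sinh (Real.pi * r))) ^ (1 / 2 : ℝ)
        ≤ max ‖twistedGamma N w ε r θ₁ ((σ : ℂ) + Complex.I * t)‖
            ‖twistedGamma N w ε r θ₂ ((σ : ℂ) + Complex.I * t)‖) ∧
    ((∃ t : ℝ, Real.cos θ₁ ≤ (4 + |t ^ 2 - r ^ 2|) ^ (-(1 / 2) : ℝ)) →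
      criticalZeros N w ε r θ₁ ∩ criticalZeros N w ε r θ₂ = ∅) := by
  have hr0 : 0 < r := by linarith
  have hc1 : 0 < Real.cos θ₁ := Real.cos_pos_of_mem_Ioo ⟨by linarith, by linarith⟩
  have hc2 : 0 < Real.cos θ₂ := by rw [hcos]; positivity
  refine ⟨fun σ t hσ hσ1 hx => two_thirds_le_max_norm_twistedGamma hN hw hε hr hc1 hcos hσ hσ1
    (sq_mul_le_one_of_le_rpow hc1.le (abs_nonneg _) hx), ?_⟩
  rintro ⟨t₀, ht₀⟩
  have h4 : Real.cos θ₁ ^ 2 ≤ 1 / 4 := by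
    have := sq_mul_le_one_of_le_rpow hc1.le (abs_nonneg _) ht₀
    nlinarith [abs_nonneg (t₀ ^ 2 - r ^ 2), sq_nonneg (Real.cos θ₁)]
  rw [Set.eq_empty_iff_forall_notMem]
  rintro t ⟨hz1, hz2⟩
  have hx : Real.cos θ₂ ^ 2 = Real.exp (-(Real.pi / r)) * Real.cos θ₁ ^ 2 := by
    rw [hcos, mul_pow, ← Real.exp_nat_mul]
    congr 2
    push_cast
    field_simp
  have hre : 0 < ((1 / 2 : ℂ) + Complex.I * t).re := by norm_num
  exact hypergeometric_no_common_zero hε hr (by positivity) h4 hx rfl rfl rfl rfl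
    (hypergeometric_eq_zero_of_twistedGamma_eq_zero hN hw hc1 hre hz1)
    (hypergeometric_eq_zero_of_twistedGamma_eq_zero hN hw hc2 hre hz2)
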